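/- Let $D=\pm 2^{\sigma}\,p_1\cdots p_r\,(q_1\cdots q_s)^2\,(l_1\cdots l_t)^3$ be a nonzero integer, where $0\le\sigma\le 3$ and the $p_i,q_j,l_k$ are pairwise distinct odd primes ($r,s,t\ge 0$), and let $E_D$ be the elliptic curve $y^2=x^3+Dx$. For a prime $p$ of good reduction put $a_p(E_D)=p+1-\#\tilde E_D(\mathbb F_p)$. For an integer $m$ let $Q(m,N)$ be the set of primes $p\le N$ of the form $p=m^2+x^2$ with $x\in\mathbb Z$, and let $$a_p(2m)=\lim_{N\to\infty}\frac{\#\{p\in Q(m,N): E_D \text{ has good reduction at } p,\ a_p(E_D)=2m\}}{\#Q(m,N)}.$$ For $i\in\{1,7\}$ let $r_i$ (resp. $t_i$) be the number of primes among $p_1,\dots,p_r$ (resp. $l_1,\dots,l_t$) congruent to $i$ modulo $8$. Let $\tau$ be the multiplicative function with, for a prime $l$ and $k\ge1$, $\tau(l^k)=l^k$ if $l=2$ or $l\equiv 3\pmod 4$, and $\tau(l^k)=l^{k-1}(l-2)$ if $l\equiv 1\pmod 4$. Assume the Hardy–Littlewood Conjecture: for all integers $a,b,c$ with $a>0$,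 $\gcd(a,b,c)=1$, $a+b$ and $c$ not both even, and $\Delta=b^2-4ac$ not a square, the number $P(n)$ of primes less than $n$ of the form $ax^2+bx+c$ with $x\in\mathbb Z_{\ge0}$ satisfies $P(n)\sim\delta(a,b,c)\,\sqrt n/\log n$ as $n\to\infty$, where $$\delta(a,b,c)=\frac{\gcd(2,a+b)}{\sqrt a}\prod_{\substack{p\mid a,\ p\mid b\\ p>2}}\frac{p}{p-1}\ \prod_{\substack{p\nmid a\\ p>2}}\Bigl(1-\frac{\left(\frac{\Delta}{p}\right)}{p-1}\Bigr),$$ the last (convergent) product being taken over the primes in increasing order. Then the following densities $a_p(2)$ and $a_p(-2)$ exist and have the stated values. (1) If $D\equiv 1\pmod 4$, or $4\mid D$ and $D/4\equiv 3\pmod 4$, then $$a_p(\pm2)=\frac14\left(1+\frac{(-1)^{r+t}}{\tau(p_1\cdots p_r\,l_1\cdots l_t)}\pm\frac{2(-1)^{r_1+r_7+s+t_1+t_7}}{\tau(p_1\cdots p_r\,q_1\cdots q_s\,l_1\cdots l_t)}\right).$$ (2) If $D\equiv 3\pmod 4$, or $4\mid D$ and $D/4\equiv 1\pmod 4$, then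 $$a_p(2)=a_p(-2)=\frac14\left(1+\frac{(-1)^{r+t}}{\tau(p_1\cdots p_r\,l_1\cdots l_t)}\right).$$ (3) If $2\,\|\,D$ or $8\,\|\,D$, then $a_p(2)=a_p(-2)=\frac14$. -/

import Mathlib

open Filter Topology Asymptotics

namespace LangTrotter

noncomputable section

/-! ### The Hardy-Littlewood conjecture for quadratic polynomials -/

/-- `P(n)`: the number of primes less than `n` of the form `a x ^ 2 + b x + c`, where `x` runs
through the natural numbers. -/
def quadraticPrimeCount (a b c : ℤ) (n : ℕ) : ℕ :=
  {p : ℕ | p.Prime ∧ p < n ∧ ∃ x : ℕ, (p : ℤ) = a * (x : ℤ) ^ 2 + b * (x : ℤ) + c}.ncard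

/-- The factor `∏ p / (p - 1)` over the odd primes dividing both `a` and `b` (here `a ≠ 0`). -/
def commonFactorProduct (a b : ℤ) : ℝ :=
  ∏ p ∈ a.natAbs.primeFactors.filter (fun p : ℕ => 2 < p ∧ (p : ℤ) ∣ b), (p : ℝ) / ((p : ℝ) - 1)

/-- The partial product over the odd primes `p < N` not dividing `a` of `1 - (D / p) / (p - 1)`,
where `D = b ^ 2 - 4 a c`. The Jacobi symbol at a prime is the Legendre symbol. -/
def singularPartialProduct (a b c : ℤ) (N : ℕ) : ℝ :=
  ∏ p ∈ (Finset.range N).filter (fun p : ℕ => p.Prime ∧ 2 < p ∧ ¬ (p : ℤ) ∣ a),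
    (1 - (jacobiSym (b ^ 2 - 4 * a * c) p : ℝ) / ((p : ℝ) - 1))

/-- `δ` is the Hardy-Littlewood constant `δ(a, b, c)`. Its infinite product converges only
conditionally, and is taken over the primes in increasing order. -/
def IsHardyLittlewoodConstant (a b c : ℤ) (δ : ℝ) : Prop :=
  Tendsto (fun N : ℕ => (Int.gcd 2 (a + b) : ℝ) / Real.sqrt (a : ℝ) *
    commonFactorProduct a b * singularPartialProduct a b c N) atTop (𝓝 δ)

/-- The Hardy-Littlewood conjecture: if `a > 0`, `gcd(a, b, c) = 1`, the integers `a + b` and `c`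
are not both even and `b ^ 2 - 4 a c` is not a square, then `P(n) ∼ δ(a, b, c) √n / log n`. -/
def HardyLittlewoodConjecture : Prop :=
  ∀ a b c : ℤ, 0 < a → Int.gcd (Int.gcd a b : ℤ) c = 1 → ¬ (Even (a + b) ∧ Even c) →
    ¬ IsSquare (b ^ 2 - 4 * a * c) →
    ∃ δ : ℝ, IsHardyLittlewoodConstant a b c δ ∧
      (fun n : ℕ => (quadraticPrimeCount a b c n : ℝ)) ~[atTop]
        (fun n : ℕ => δ * (Real.sqrt (n : ℝ) / Real.log (n : ℝ)))

/-! ### The curve `y ^ 2 = x ^ 3 + D x` and its traces of Frobenius -/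

/-- The Weierstrass equation `E_D : y ^ 2 = x ^ 3 + D x`. -/
def curve (D : ℤ) : WeierstrassCurve ℤ where
  a₁ := 0
  a₂ := 0
  a₃ := 0
  a₄ := D
  a₆ := 0

/-- `a_p(E_D) = p + 1 - #Ẽ_D(𝔽_p)`, meant for primes `p` of good reduction. The type of points
includes the point at infinity. -/
def frobeniusTrace (D : ℤ) (p : ℕ) : ℤ :=
  (p : ℤ) + 1 -
    (Nat.card (WeierstrassCurve.Affine.Point ((curve D).map (Int.castRingHom (ZMod p)))) : ℤ)

/-- `Q(r, N)`: the primes `p ≤ N` of the form `r ^ 2 + x ^ 2`. -/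
def primesOfForm (r : ℤ) (N : ℕ) : Set ℕ :=
  {p : ℕ | p.Prime ∧ p ≤ N ∧ ∃ x : ℤ, (p : ℤ) = r ^ 2 + x ^ 2}

/-- The natural density `a_p(E_D, 2 r)` exists and equals `d`: it is the limit of the proportion,
among the primes in `Q(r, N)`, of those of good reduction for `E_D` with `a_p(E_D) = 2 r`. -/
def HasTraceDensity (D r : ℤ) (d : ℝ) : Prop :=
  Tendsto (fun N : ℕ =>
    ({p : ℕ | p ∈ primesOfForm r N ∧ ¬ (p : ℤ) ∣ (curve D).Δ ∧
        frobeniusTrace D p = 2 * r}.ncard : ℝ) /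
      ((primesOfForm r N).ncard : ℝ)) atTop (𝓝 d)

/-! ### The arithmetic functions in the density formulas -/

/-- The multiplicative function `τ` with `τ(l ^ k) = l ^ k` if `l = 2` or `l ≡ 3 (mod 4)`, and
`τ(l ^ k) = l ^ (k - 1) (l - 2)` if `l ≡ 1 (mod 4)`, for primes `l` and `k ≥ 1`. -/
def tau (n : ℕ) : ℕ :=
  ∏ l ∈ n.primeFactors,
    if l % 4 = 1 then l ^ (n.factorization l - 1) * (l - 2) else l ^ n.factorization l

/-- The number of `l ∈ S` with `l ≡ i (mod 8)`. -/
def countMod8 (S : Finset ℕ) (i : ℕ) : ℕ := (S.filter fun l => l ≡ i [MOD 8]).card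

end

end LangTrotter

/-!
Write an odd prime of the form in question as `p = 1 + x ^ 2`; then `x` is even and `x` is a square
root of `-1` modulo `p`.

*From traces to quartic residues.* The trace of `E_D` at `p` is `-S(D)`, where `S(k)` is the sum of
the quadratic characters of `x ^ 3 + k x`. The summand is invariant under `x ↦ -x` and `x ↦ k / x`,
which determines `S(k)` modulo `4` for nonsquare `k` and `S(1)` modulo `8`. With Jacobsthal's
identity `S(1) ^ 2 + S(n) ^ 2 = 4 p` and the uniqueness of `p = 1 + x ^ 2` as a sum of two squares
this gives `S(1) = -2` (`cubicCharSum_one_eq`), and then the trace of `E_D` is `2` or `-2` exactly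
when `D ^ ((p - 1) / 4)` is `1` or `-1` modulo `p` (`frobeniusTrace_eq_iff`).

*Reciprocity.* The Jacobi sum of the quartic character `χ` modulo `p` is `± (1 + x i)`, so the
fourth power of its Gauss sum is `π ^ 3 π'` with `π = 1 + x i` and `π' = 1 - x i`. Taking the Gauss
sum in characteristic `q` and raising it to the power `q` expresses `χ (± q)` through `x` modulo `q`
(`quartic_reciprocity`). The Cayley transform `c ↦ (1 - c i) / (1 + c i)` identifies the residue
classes with `c ^ 2 ≠ -1` with the nontrivial elements `u ≠ -1` of a cyclic group, on which the
symbol is a character of order four; this gives the moments of the symbol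
(`exists_isLocalSymbol`). The values at `-1` and `2` depend on `x` modulo `8` only.

*Equidistribution.* For a fixed even `M` all polynomials `(M y + c) ^ 2 + 1` with `1 + c ^ 2` prime
to `M` have the same Hardy-Littlewood constant, which is not zero because a prime of this form
exists. Hence the primes `1 + x ^ 2` are equidistributed over these classes `c`
(`tendsto_density`), and no infinite product has to be evaluated. By the Chinese remainder theorem
the proportion of classes with `χ D = ± 1` is given by products of the local moments
(`hasTraceDensity_of_factorization`).
-/

namespace LangTrotter

/-! ### The character sum of `x ^ 3 + k x` over a finite field -/

section CharacterSum

variable {F : Type*} [Field F] [DecidableEq F]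

/-- The group of order four generated by `x ↦ -x` and `x ↦ k / x` acts freely on a set of elements
`x` with `x ^ 4 ≠ k ^ 2`. -/
lemma four_dvd_card {k : F} (h2 : (2 : F) ≠ 0) (hk : k ≠ 0) (B : Finset F)
    (h0 : ∀ x ∈ B, x ≠ 0 ∧ x ^ 2 ≠ k ∧ x ^ 2 ≠ -k) (hneg : ∀ x ∈ B, -x ∈ B)
    (hinv : ∀ x ∈ B, k / x ∈ B) : 4 ∣ B.card := by
  -- The fibres of this invariant are the orbits.
  set h : F → F := fun x => x ^ 2 + k ^ 2 / x ^ 2 with hh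
  rw [Finset.card_eq_sum_card_image h B]
  refine Finset.dvd_sum fun w hw => ?_
  obtain ⟨x, hx, rfl⟩ := Finset.mem_image.mp hw
  obtain ⟨hx0, hxk, hxk'⟩ := h0 x hx
  have key : B.filter (fun y => h y = h x) = {x, -x, k / x, -(k / x)} := by
    ext y
    simp only [Finset.mem_filter, Finset.mem_insert, Finset.mem_singleton]
    constructor
    · rintro ⟨hy, hyx⟩
      have hy0 := (h0 y hy).1
      simp only [hh] at hyx
      field_simp at hyx
      have h3 : (y - x) * (y + x) * ((x * y - k) * (x * y + k)) = 0 := by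
        linear_combination hyx
      rcases mul_eq_zero.mp h3 with h4 | h4 <;> rcases mul_eq_zero.mp h4 with h5 | h5
      · exact Or.inl (by linear_combination h5)
      · exact Or.inr (Or.inl (by linear_combination h5))
      · refine Or.inr (Or.inr (Or.inl ?_))
        rw [eq_div_iff hx0]; linear_combination h5
      · refine Or.inr (Or.inr (Or.inr ?_))
        rw [← neg_div, eq_div_iff hx0]; linear_combination h5
    · rintro (rfl | rfl | rfl | rfl)
      · exact ⟨hx, rfl⟩
      · exact ⟨hneg _ hx, by simp [hh]⟩
      · refine ⟨hinv _ hx, ?_⟩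
        simp only [hh]; field_simp; ring
      · refine ⟨hneg _ (hinv _ hx), ?_⟩
        simp only [hh]; field_simp; ring
  rw [key]
  have hne : ∀ z : F, z ≠ 0 → z ≠ -z := fun z hz hz' => by
    have : 2 * z = 0 := by linear_combination hz'
    exact (mul_ne_zero h2 hz) this
  have e1 : x ≠ k / x := fun h' => hxk (by rw [eq_div_iff hx0] at h'; linear_combination h')
  have e2 : x ≠ -(k / x) := fun h' => hxk' (by
    rw [← neg_div, eq_div_iff hx0] at h'; linear_combination h')
  have e3 : -x ≠ k / x := fun h' => e2 (by rw [← h', neg_neg])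
  have e4 : -x ≠ -(k / x) := fun h' => e1 (neg_injective h')
  rw [Finset.card_insert_of_notMem, Finset.card_insert_of_notMem, Finset.card_insert_of_notMem,
    Finset.card_singleton]
  · simpa using hne _ (div_ne_zero hk hx0)
  · simp [e3, e1]
  · simp [hne x hx0, e1, e2]

variable [Fintype F]

/-- The sum of the quadratic characters of the values of `x ^ 3 + k x`. -/
def cubicCharSum (k : F) : ℤ := ∑ x : F, quadraticChar F (x ^ 3 + k * x)

lemma quadraticChar_eq_of_mul_sq {a b t : F} (ht : t ≠ 0) (h : a = t ^ 2 * b) :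
    quadraticChar F a = quadraticChar F b := by
  rw [h, map_mul, quadraticChar_sq_one' ht, one_mul]

lemma cubicCharSum_mul_sq (k : F) {t : F} (ht : t ≠ 0) :
    cubicCharSum (k * t ^ 2) = quadraticChar F t * cubicCharSum k := by
  unfold cubicCharSum
  rw [Finset.mul_sum]
  refine (Fintype.sum_equiv (Equiv.mulLeft₀ t ht) _ _ fun x => ?_).symm
  rw [← map_mul]
  refine (quadraticChar_eq_of_mul_sq ht ?_).symm
  simp only [Equiv.mulLeft₀_apply]
  ring

/-- Each `-1` changes a sum of signs by `-2`, so four of them change it by a multiple of `8`. -/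
lemma sum_modEq_card {ι : Type*} (s : Finset ι) (f : ι → ℤ) (hf : ∀ x ∈ s, f x = 1 ∨ f x = -1)
    (h4 : 4 ∣ (s.filter fun x => f x = -1).card) : ∑ x ∈ s, f x ≡ s.card [ZMOD 8] := by
  obtain ⟨m, hm⟩ := h4
  have h1 : ∀ x ∈ s, f x = 1 - 2 * (if f x = -1 then 1 else 0) := by
    intro x hx
    rcases hf x hx with h | h <;> simp [h]
  rw [Finset.sum_congr rfl h1, Finset.sum_sub_distrib, ← Finset.mul_sum, ← Finset.sum_filter]
  simp only [Finset.sum_const, hm, nsmul_eq_mul, mul_one]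
  apply Int.ModEq.symm
  rw [Int.modEq_iff_dvd]
  exact ⟨-m, by push_cast; ring⟩

/-- The values of the quadratic character on `x ^ 3 + k x` are invariant under `x ↦ -x` and
`x ↦ k / x`; so the sum over the arguments that are not fixed by an element of this group is
determined modulo `8`. -/
lemma sum_quadraticChar_cubic_modEq {k : F} (h2 : (2 : F) ≠ 0) (hk : k ≠ 0)
    (hm1 : quadraticChar F (-1) = 1) :
    ∑ x with x ≠ 0 ∧ x ^ 2 ≠ k ∧ x ^ 2 ≠ -k, quadraticChar F (x ^ 3 + k * x) ≡
      ((Finset.univ.filter fun x : F => x ≠ 0 ∧ x ^ 2 ≠ k ∧ x ^ 2 ≠ -k).card : ℤ) [ZMOD 8] := by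
  apply sum_modEq_card
  · intro x hx
    rw [Finset.mem_filter] at hx
    obtain ⟨-, hx0, -, hx2⟩ := hx
    apply quadraticChar_dichotomy
    have : x ^ 3 + k * x = x * (x ^ 2 - -k) := by ring
    rw [this]
    exact mul_ne_zero hx0 (sub_ne_zero.mpr hx2)
  · apply four_dvd_card h2 hk
    · intro x hx
      simpa using (Finset.mem_filter.mp (Finset.mem_filter.mp hx).1).2
    · intro x hx
      simp only [Finset.mem_filter, Finset.mem_univ, true_and] at hx ⊢
      refine ⟨by simpa using hx.1, ?_⟩
      have : (-x) ^ 3 + k * (-x) = (-1) * (x ^ 3 + k * x) := by ring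
      rw [this, map_mul, hm1, hx.2, one_mul]
    · intro x hx
      simp only [Finset.mem_filter, Finset.mem_univ, true_and] at hx ⊢
      obtain ⟨⟨hx0, hx1, hx2⟩, hx3⟩ := hx
      refine ⟨⟨div_ne_zero hk hx0, ?_, ?_⟩, ?_⟩
      · intro h'
        rw [div_pow, div_eq_iff (pow_ne_zero 2 hx0)] at h'
        exact hx1 (mul_left_cancel₀ hk (by linear_combination -h'))
      · intro h'
        rw [div_pow, div_eq_iff (pow_ne_zero 2 hx0)] at h'
        exact hx2 (mul_left_cancel₀ hk (by linear_combination h'))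
      · rw [← hx3]
        refine quadraticChar_eq_of_mul_sq (t := k / x ^ 2) (div_ne_zero hk (pow_ne_zero 2 hx0)) ?_
        field_simp
        ring

/-- For a nonsquare `k` no nonzero element is fixed by `x ↦ -x`, `x ↦ ± k / x`. -/
lemma cubicCharSum_modEq_of_not_isSquare {k : F} (h2 : (2 : F) ≠ 0)
    (hm1 : quadraticChar F (-1) = 1) (hq : (Fintype.card F : ℤ) ≡ 1 [ZMOD 4])
    (hk : ¬ IsSquare k) : cubicCharSum k ≡ 0 [ZMOD 4] := by
  have hk0 : k ≠ 0 := by rintro rfl; exact hk (IsSquare.zero)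
  have hsq : IsSquare (-1 : F) := (quadraticChar_one_iff_isSquare (by simp)).mp hm1
  have h1 : ∀ x : F, x ^ 2 ≠ k := fun x hx => hk ⟨x, by rw [← hx, sq]⟩
  have h1' : ∀ x : F, x ^ 2 ≠ -k := fun x hx => hk (by
    have : k = -1 * x ^ 2 := by rw [hx]; ring
    rw [this]; exact hsq.mul ⟨x, sq x⟩)
  have h := sum_quadraticChar_cubic_modEq h2 hk0 hm1
  have hf : (Finset.univ.filter fun x : F => x ≠ 0 ∧ x ^ 2 ≠ k ∧ x ^ 2 ≠ -k) =
      Finset.univ.erase 0 := by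
    ext x; simp [h1, h1']
  rw [hf, Finset.card_erase_of_mem (Finset.mem_univ _), Finset.card_univ,
    Nat.cast_sub Fintype.card_pos] at h
  have h3 : cubicCharSum k = ∑ x ∈ Finset.univ.erase 0, quadraticChar F (x ^ 3 + k * x) := by
    rw [cubicCharSum, ← Finset.add_sum_erase _ _ (Finset.mem_univ (0 : F))]
    simp
  rw [h3]
  have h4 := h.of_dvd (show (4 : ℤ) ∣ 8 by norm_num)
  exact h4.trans (by simpa using hq.sub_right 1)

/-- For `k = 1` the fixed elements are `± 1`, which contribute `2` times the quadratic character of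
`2`, and the zeros `0`, `± i` of `x ^ 3 + x`. -/
lemma cubicCharSum_one_modEq (h2 : (2 : F) ≠ 0) (hm1 : quadraticChar F (-1) = 1)
    (hq : (Fintype.card F : ℤ) ≡ 1 [ZMOD 4])
    (hq2 : quadraticChar F 2 = 1 ↔ (Fintype.card F : ℤ) ≡ 1 [ZMOD 8]) :
    cubicCharSum (1 : F) ≡ -2 [ZMOD 8] := by
  obtain ⟨i, hi⟩ : IsSquare (-1 : F) := (quadraticChar_one_iff_isSquare (by simp)).mp hm1
  have h := sum_quadraticChar_cubic_modEq h2 (one_ne_zero (α := F)) hm1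
  have hi0 : i ≠ 0 := by rintro rfl; simp at hi
  have h11 : (1 : F) ≠ -1 := fun h' => h2 (by linear_combination h')
  have hii : i ≠ -i := fun h' => by
    have : 2 * i = 0 := by linear_combination h'
    exact mul_ne_zero h2 hi0 this
  have hi1 : i ≠ 1 := by rintro rfl; exact h11 (by linear_combination -hi)
  have hi2 : i ≠ -1 := by rintro rfl; exact h11 (by linear_combination -hi)
  obtain ⟨s, hs⟩ : ∃ s : Finset F, s = {0, 1, -1, i, -i} := ⟨_, rfl⟩
  have hf : (Finset.univ.filter fun x : F => x ≠ 0 ∧ x ^ 2 ≠ 1 ∧ x ^ 2 ≠ -1) =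
      Finset.univ \ s := by
    ext x
    have e1 : x ^ 2 = 1 ↔ x = 1 ∨ x = -1 := by rw [sq, mul_self_eq_one_iff]
    have e2 : x ^ 2 = -1 ↔ x = i ∨ x = -i := by rw [hi, ← sq, sq_eq_sq_iff_eq_or_eq_neg]
    rw [Finset.mem_filter, Finset.mem_sdiff, hs]
    simp only [Finset.mem_univ, true_and, ne_eq, e1, e2, Finset.mem_insert, Finset.mem_singleton,
      not_or, and_assoc]
  have hs0 : (0 : F) ∉ ({1, -1, i, -i} : Finset F) := by simp [hi0, eq_comm]
  have hs1 : (1 : F) ∉ ({-1, i, -i} : Finset F) := by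
    simp only [Finset.mem_insert, Finset.mem_singleton, not_or]
    exact ⟨h11, hi1.symm, fun h' => hi2 (by rw [h', neg_neg])⟩
  have hs2 : (-1 : F) ∉ ({i, -i} : Finset F) := by
    simp only [Finset.mem_insert, Finset.mem_singleton, not_or]
    exact ⟨hi2.symm, fun h' => hi1 (neg_injective h'.symm)⟩
  have hs3 : i ∉ ({-i} : Finset F) := by simpa using hii
  have hcard : s.card = 5 := by
    rw [hs, Finset.card_insert_of_notMem hs0, Finset.card_insert_of_notMem hs1,
      Finset.card_insert_of_notMem hs2, Finset.card_insert_of_notMem hs3, Finset.card_singleton]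
  have hsum : ∑ x ∈ s, quadraticChar F (x ^ 3 + 1 * x) = 2 * quadraticChar F 2 := by
    rw [hs, Finset.sum_insert hs0, Finset.sum_insert hs1, Finset.sum_insert hs2,
      Finset.sum_insert hs3, Finset.sum_singleton]
    have e1 : i ^ 3 + 1 * i = 0 := by linear_combination -i * hi
    have e2 : (-i) ^ 3 + 1 * (-i) = 0 := by linear_combination i * hi
    have e3 : (-1 : F) ^ 3 + 1 * (-1) = -1 * 2 := by norm_num
    have e4 : (1 : F) ^ 3 + 1 * 1 = 2 := by norm_num
    rw [e1, e2, e3, e4, map_mul, hm1]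
    simp; ring
  have hsc : s.card ≤ Fintype.card F := Finset.card_le_univ s
  rw [hf, Finset.card_sdiff_of_subset (Finset.subset_univ s), Finset.card_univ,
    Nat.cast_sub hsc, hcard] at h
  have h3 : cubicCharSum (1 : F) = ∑ x ∈ Finset.univ \ s, quadraticChar F (x ^ 3 + 1 * x)
      + 2 * quadraticChar F 2 := by
    rw [cubicCharSum, ← hsum, Finset.sum_sdiff (Finset.subset_univ s)]
  rw [h3]
  generalize (∑ x ∈ Finset.univ \ s, quadraticChar F (x ^ 3 + 1 * x)) = A at h
  generalize Fintype.card F = q at *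
  unfold Int.ModEq at *
  rcases quadraticChar_dichotomy h2 with h' | h' <;> rw [h'] at hq2 ⊢ <;> push_cast at h <;> omega

/-! ### The Jacobsthal sums -/

lemma sum_quadraticChar_mul_add (hF : ringChar F ≠ 2) (d : F) :
    ∑ k : F, quadraticChar F (k * (k + d)) = (if d = 0 then (Fintype.card F : ℤ) else 0) - 1 := by
  split_ifs with hd
  · subst hd
    rw [← Finset.add_sum_erase _ _ (Finset.mem_univ (0 : F))]
    rw [Finset.sum_congr rfl (g := fun _ => 1)]
    · simp [Finset.card_erase_of_mem, Nat.cast_sub (Fintype.card_pos (α := F))]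
    · intro x hx
      rw [add_zero, ← sq, quadraticChar_sq_one' (Finset.ne_of_mem_erase hx)]
  · -- For `k ≠ 0` the value is that at `1 + d / k`, which runs through all elements but `1`.
    rw [← Finset.add_sum_erase _ _ (Finset.mem_univ (0 : F))]
    have h0 := quadraticChar_sum_zero hF
    rw [← Finset.add_sum_erase _ _ (Finset.mem_univ (1 : F))] at h0
    have : ∑ k ∈ Finset.univ.erase (0 : F), quadraticChar F (k * (k + d)) =
        ∑ w ∈ Finset.univ.erase (1 : F), quadraticChar F w := by
      refine Finset.sum_bij' (fun k _ => 1 + d / k) (fun w _ => d / (w - 1)) ?_ ?_ ?_ ?_ ?_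
      · intro k hk
        simpa [hd] using hk
      · intro w hw
        have hw' : w - 1 ≠ 0 := sub_ne_zero.mpr (by simpa using hw)
        simp [hd, hw']
      · intro k hk
        have hk' : k ≠ 0 := by simpa using hk
        rw [add_sub_cancel_left, div_div_cancel₀ hd]
      · intro w hw
        have hw' : w - 1 ≠ 0 := sub_ne_zero.mpr (by simpa using hw)
        rw [div_div_cancel₀ hd]; ring
      · intro k hk
        have hk' : k ≠ 0 := by simpa using hk
        exact quadraticChar_eq_of_mul_sq hk' (by field_simp)
    rw [this]
    simp at h0 ⊢
    linarith

lemma sum_quadraticChar_of_sq_eq (hF : ringChar F ≠ 2) (hm1 : quadraticChar F (-1) = 1) (x : F) :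
    ∑ y : F, (if y ^ 2 - x ^ 2 = 0 then quadraticChar F x * quadraticChar F y else 0) =
      if x = 0 then 0 else 2 := by
  have h2 : (2 : F) ≠ 0 := Ring.two_ne_zero hF
  split_ifs with hx
  · simp [hx]
  · rw [← Finset.sum_filter]
    have : (Finset.univ.filter fun y : F => y ^ 2 - x ^ 2 = 0) = {x, -x} := by
      ext y; simp [sub_eq_zero, sq_eq_sq_iff_eq_or_eq_neg]
    rw [this, Finset.sum_pair]
    · rw [neg_eq_neg_one_mul, map_mul, hm1]
      have := quadraticChar_sq_one hx
      linear_combination 2 * this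
    · intro h'
      have : 2 * x = 0 := by linear_combination h'
      exact mul_ne_zero h2 hx this

/-- Summing over `k` first leaves only the pairs `x`, `y` with `x ^ 2 = y ^ 2`. -/
lemma sum_cubicCharSum_sq (hF : ringChar F ≠ 2) (hm1 : quadraticChar F (-1) = 1) :
    ∑ k : F, cubicCharSum k ^ 2 = 2 * Fintype.card F * (Fintype.card F - 1) := by
  have h1 : ∀ k : F, cubicCharSum k ^ 2 = ∑ x : F, ∑ y : F,
      quadraticChar F x * quadraticChar F y * quadraticChar F ((k + x ^ 2) * (k + y ^ 2)) := by
    intro k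
    rw [sq, cubicCharSum, Finset.sum_mul_sum]
    refine Finset.sum_congr rfl fun x _ => Finset.sum_congr rfl fun y _ => ?_
    simp only [← map_mul]
    congr 1; ring
  have h2 : ∀ x y : F, ∑ k : F, quadraticChar F ((k + x ^ 2) * (k + y ^ 2)) =
      (if y ^ 2 - x ^ 2 = 0 then (Fintype.card F : ℤ) else 0) - 1 := by
    intro x y
    rw [← sum_quadraticChar_mul_add hF]
    refine Fintype.sum_equiv (Equiv.addRight (x ^ 2)) _ _ fun k => ?_
    simp only [Equiv.coe_addRight]
    congr 1; ring
  have h4 : ∀ x : F, ∑ k : F, ∑ y : F,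
      quadraticChar F x * quadraticChar F y * quadraticChar F ((k + x ^ 2) * (k + y ^ 2)) =
      ∑ y : F, quadraticChar F x * quadraticChar F y *
        ((if y ^ 2 - x ^ 2 = 0 then (Fintype.card F : ℤ) else 0) - 1) := by
    intro x
    rw [Finset.sum_comm]
    exact Finset.sum_congr rfl fun y _ => by rw [← Finset.mul_sum, h2]
  rw [Finset.sum_congr rfl fun k _ => h1 k, Finset.sum_comm, Finset.sum_congr rfl fun x _ => h4 x]
  simp only [mul_sub, mul_one, Finset.sum_sub_distrib]
  rw [← Finset.sum_mul_sum, quadraticChar_sum_zero hF]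
  have h3 : ∀ x y : F, quadraticChar F x * quadraticChar F y *
      (if y ^ 2 - x ^ 2 = 0 then (Fintype.card F : ℤ) else 0) = (Fintype.card F : ℤ) *
      (if y ^ 2 - x ^ 2 = 0 then quadraticChar F x * quadraticChar F y else 0) := by
    intro x y; split_ifs <;> ring
  simp_rw [h3, ← Finset.mul_sum, sum_quadraticChar_of_sq_eq hF hm1]
  rw [← Finset.add_sum_erase _ _ (Finset.mem_univ (0 : F)),
    Finset.sum_congr rfl (g := fun _ => (2 : ℤ)) (fun x hx => if_neg (Finset.ne_of_mem_erase hx))]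
  simp [Finset.card_erase_of_mem, Nat.cast_sub (Fintype.card_pos (α := F))]
  ring

/-- Jacobsthal's identity. -/
lemma cubicCharSum_sq_add_sq (hF : ringChar F ≠ 2) (hm1 : quadraticChar F (-1) = 1) {n : F}
    (hn : quadraticChar F n = -1) :
    cubicCharSum (1 : F) ^ 2 + cubicCharSum n ^ 2 = 4 * Fintype.card F := by
  have hn0 : n ≠ 0 := by rintro rfl; simp at hn
  have h0 : cubicCharSum (0 : F) = 0 := by
    rw [cubicCharSum, ← quadraticChar_sum_zero hF]
    refine Finset.sum_congr rfl fun x _ => ?_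
    by_cases hx : x = 0
    · simp [hx]
    · exact quadraticChar_eq_of_mul_sq hx (by ring)
  have hsq : ∀ (m t : F), t ≠ 0 → cubicCharSum (m * t ^ 2) ^ 2 = cubicCharSum m ^ 2 := by
    intro m t ht
    rw [cubicCharSum_mul_sq m ht, mul_pow, quadraticChar_sq_one ht, one_mul]
  have hk : ∀ k ∈ Finset.univ.erase (0 : F), 2 * cubicCharSum k ^ 2 =
      (cubicCharSum (1 : F) ^ 2 + cubicCharSum n ^ 2) +
      (cubicCharSum (1 : F) ^ 2 - cubicCharSum n ^ 2) * quadraticChar F k := by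
    intro k hk
    have hk0 : k ≠ 0 := Finset.ne_of_mem_erase hk
    rcases quadraticChar_dichotomy hk0 with h | h
    · obtain ⟨t, ht⟩ := (quadraticChar_one_iff_isSquare hk0).mp h
      have ht0 : t ≠ 0 := by rintro rfl; simp at ht; exact hk0 ht
      have : k = 1 * t ^ 2 := by rw [ht]; ring
      rw [h, this, hsq _ _ ht0]; ring
    · have hkn : quadraticChar F (k * n) = 1 := by rw [map_mul, h, hn]; norm_num
      obtain ⟨t, ht⟩ := (quadraticChar_one_iff_isSquare (mul_ne_zero hk0 hn0)).mp hkn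
      have ht0 : t ≠ 0 := by rintro rfl; simp at ht; tauto
      have : k = n * (t / n) ^ 2 := by field_simp; linear_combination ht
      rw [h, this, hsq _ _ (div_ne_zero ht0 hn0)]; ring
  have hs := sum_cubicCharSum_sq hF hm1
  have hs0 := quadraticChar_sum_zero hF
  rw [← Finset.add_sum_erase _ _ (Finset.mem_univ (0 : F)), h0] at hs
  rw [← Finset.add_sum_erase _ _ (Finset.mem_univ (0 : F)), quadraticChar_zero, zero_add] at hs0
  have h4 := Finset.sum_congr rfl hk
  rw [← Finset.mul_sum, Finset.sum_add_distrib, ← Finset.mul_sum, hs0] at h4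
  simp only [Finset.sum_const, Finset.card_erase_of_mem (Finset.mem_univ (0 : F)),
    Finset.card_univ, nsmul_eq_mul, Nat.cast_sub (Fintype.card_pos (α := F))] at h4
  have h5 : (Fintype.card F : ℤ) - 1 ≠ 0 := by
    have : (1 : ℤ) < Fintype.card F := by exact_mod_cast Fintype.one_lt_card
    omega
  apply mul_left_cancel₀ h5
  push_cast at h4
  linear_combination -h4 + 2 * hs

end CharacterSum

/-! ### Traces of Frobenius at the primes `p = 1 + x ^ 2` -/

/-- Uniqueness of the representation `p = 1 + x ^ 2` as a sum of two squares, where divisibility by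
the Gaussian prime `1 + x i` also fixes the sign of the imaginary part. -/
lemma sum_sq_eq_one_add_sq_of_dvd {p A B x : ℤ} (hp : 0 < p) (hx : p = 1 + x ^ 2) (hxe : Even x)
    (hA : Odd A) (hAB : A ^ 2 + B ^ 2 = p) (hd : p ∣ A + B * x) :
    (A = 1 ∨ A = -1) ∧ B = A * x := by
  obtain ⟨k, hk⟩ := hd
  have h1 : (p * k) ^ 2 + (A * x - B) ^ 2 = p ^ 2 := by
    rw [← hk]; linear_combination (1 + x ^ 2) * hAB - p * hx
  have hk0 : k ≠ 0 := by
    rintro rfl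
    have h2 : A = -(B * x) := by linear_combination hk
    have : Even A := by rw [h2]; exact (hxe.mul_left B).neg
    exact (Int.not_even_iff_odd.mpr hA) this
  have hk1 : 1 ≤ k ^ 2 := by have := sq_nonneg k; have := pow_ne_zero 2 hk0; omega
  have hB : A * x - B = 0 := by
    have : (A * x - B) ^ 2 ≤ 0 := by nlinarith [sq_nonneg p]
    exact pow_eq_zero_iff two_ne_zero |>.mp (le_antisymm this (sq_nonneg _))
  have hB' : B = A * x := by linear_combination -hB
  refine ⟨?_, hB'⟩
  have hA2 : p * A ^ 2 = p * 1 := by rw [hB'] at hAB; linear_combination hAB + A ^ 2 * hx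
  have hA1 := mul_left_cancel₀ hp.ne' hA2
  rwa [sq, mul_self_eq_one_iff] at hA1

lemma sum_sq_eq_one_add_sq {p A B x : ℤ} (hp : Prime p) (hp0 : 0 < p) (hx : p = 1 + x ^ 2)
    (hxe : Even x) (hA : Odd A) (hAB : A ^ 2 + B ^ 2 = p) : A = 1 ∨ A = -1 := by
  have h : p ∣ (A + B * x) * (A + B * -x) := ⟨1 - B ^ 2, by linear_combination hAB + B ^ 2 * hx⟩
  rcases hp.dvd_or_dvd h with h | h
  · exact (sum_sq_eq_one_add_sq_of_dvd hp0 hx hxe hA hAB h).1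
  · exact (sum_sq_eq_one_add_sq_of_dvd hp0 (by rw [hx]; ring) hxe.neg hA hAB h).1

section Trace

variable {p : ℕ} [Fact p.Prime] {x : ℕ}

lemma even_of_prime_eq (hp2 : p ≠ 2) (hx : p = 1 + x ^ 2) : Even x := by
  have := (Fact.out : p.Prime).odd_of_ne_two hp2
  by_contra h
  rw [Nat.not_even_iff_odd] at h
  have : Even p := by rw [hx]; exact Odd.add_odd odd_one h.pow
  exact (Nat.not_even_iff_odd.mpr ‹Odd p›) this

lemma mod_four_of_prime_eq (hp2 : p ≠ 2) (hx : p = 1 + x ^ 2) : p % 4 = 1 := by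
  obtain ⟨y, hy⟩ := even_of_prime_eq hp2 hx
  rw [hx, hy]; ring_nf; omega

lemma quadraticChar_neg_one_eq_one (h4 : p % 4 = 1) : quadraticChar (ZMod p) (-1) = 1 := by
  rw [quadraticChar_one_iff_isSquare (by simp), FiniteField.isSquare_neg_one_iff, ZMod.card]
  omega

/-- The curve `y ^ 2 = x ^ 3 + x` has trace `2` at every prime `p = 1 + x ^ 2`: by Jacobsthal's
identity half the character sum is the odd one of two integers whose squares add up to `p`, and the
congruence modulo `8` fixes the sign. -/
lemma cubicCharSum_one_eq (hp2 : p ≠ 2) (hx : p = 1 + x ^ 2) :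
    cubicCharSum (1 : ZMod p) = -2 := by
  have h4 := mod_four_of_prime_eq hp2 hx
  have hm1 := quadraticChar_neg_one_eq_one h4
  have hF : ringChar (ZMod p) ≠ 2 := by rwa [ZMod.ringChar_zmod_n]
  have h2 : (2 : ZMod p) ≠ 0 := Ring.two_ne_zero hF
  have hq : (Fintype.card (ZMod p) : ℤ) ≡ 1 [ZMOD 4] := by
    rw [ZMod.card]; unfold Int.ModEq; omega
  have h8 : cubicCharSum (1 : ZMod p) ≡ -2 [ZMOD 8] := by
    apply cubicCharSum_one_modEq h2 hm1 hq
    rw [quadraticChar_one_iff_isSquare h2, FiniteField.isSquare_two_iff, ZMod.card]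
    unfold Int.ModEq; omega
  obtain ⟨n, hn⟩ := quadraticChar_exists_neg_one hF
  have hn4 : cubicCharSum n ≡ 0 [ZMOD 4] :=
    cubicCharSum_modEq_of_not_isSquare h2 hm1 hq (quadraticChar_neg_one_iff_not_isSquare.mp hn)
  have hJ := cubicCharSum_sq_add_sq hF hm1 hn
  rw [ZMod.card] at hJ
  unfold Int.ModEq at h8 hn4
  obtain ⟨A, hA⟩ : ∃ A, cubicCharSum (1 : ZMod p) = 2 * A := ⟨cubicCharSum (1 : ZMod p) / 2, by omega⟩
  obtain ⟨B, hB⟩ : ∃ B, cubicCharSum n = 2 * B := ⟨cubicCharSum n / 2, by omega⟩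
  rw [hA, hB] at hJ
  have hp : Prime (p : ℤ) := Nat.prime_iff_prime_int.mp Fact.out
  have hp0 : (0 : ℤ) < p := by exact_mod_cast (Fact.out : p.Prime).pos
  have := sum_sq_eq_one_add_sq hp hp0 (x := x) (by exact_mod_cast hx)
    (by exact_mod_cast even_of_prime_eq hp2 hx) (A := A) (B := B)
    (by rw [Int.odd_iff]; omega) (by linarith)
  omega

lemma frobeniusTrace_eq {D : ℤ} (hp2 : p ≠ 2) (hD : ¬ (p : ℤ) ∣ (curve D).Δ) :
    frobeniusTrace D p = -cubicCharSum (D : ZMod p) := by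
  have hF : ringChar (ZMod p) ≠ 2 := by rwa [ZMod.ringChar_zmod_n]
  set W := (curve D).map (Int.castRingHom (ZMod p)) with hW
  have hΔ : W.Δ ≠ 0 := by
    rw [hW, WeierstrassCurve.map_Δ]
    simpa [ZMod.intCast_zmod_eq_zero_iff_dvd, ZMod.intCast_cast] using
      fun h => hD ((ZMod.intCast_zmod_eq_zero_iff_dvd _ _).mp h)
  have heq : ∀ u v : ZMod p, WeierstrassCurve.Affine.Equation W u v ↔ v ^ 2 = u ^ 3 + D * u := by
    intro u v
    rw [WeierstrassCurve.Affine.equation_iff]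
    simp [hW, curve]
  have e : WeierstrassCurve.Affine.Point W ≃
      Option (Σ u : ZMod p, {v : ZMod p // v ^ 2 = u ^ 3 + D * u}) :=
    { toFun := fun P => match P with
        | .zero => none
        | .some u v h => some ⟨u, v, (heq u v).mp h.1⟩
      invFun := fun P => match P with
        | none => .zero
        | some ⟨u, v, h⟩ => .some u v
          ((WeierstrassCurve.Affine.equation_iff_nonsingular_of_Δ_ne_zero hΔ).mp ((heq u v).mpr h))
      left_inv := by rintro (_ | _) <;> rfl
      right_inv := by rintro (_ | _) <;> rfl }
  have hcard : (Nat.card (WeierstrassCurve.Affine.Point W) : ℤ) =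
      1 + ∑ u : ZMod p, (1 + quadraticChar (ZMod p) (u ^ 3 + D * u)) := by
    rw [Nat.card_congr e, Nat.card_eq_fintype_card, Fintype.card_option, Fintype.card_sigma]
    push_cast
    rw [add_comm]
    congr 1
    refine Finset.sum_congr rfl fun u _ => ?_
    rw [add_comm (1 : ℤ), ← quadraticChar_card_sqrts hF, Set.toFinset_card]
    rfl
  rw [frobeniusTrace, hcard, Finset.sum_add_distrib, cubicCharSum]
  simp [ZMod.card]
  ring

/-- At a prime `p = 1 + x ^ 2` the quartic character of `D` decides whether the trace is `± 2`. -/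
lemma frobeniusTrace_eq_iff {D : ℤ} (hp2 : p ≠ 2) (hx : p = 1 + x ^ 2)
    (hD : ¬ (p : ℤ) ∣ (curve D).Δ) (hD0 : (D : ZMod p) ≠ 0) :
    (frobeniusTrace D p = 2 ↔ (D : ZMod p) ^ ((p - 1) / 4) = 1) ∧
    (frobeniusTrace D p = -2 ↔ (D : ZMod p) ^ ((p - 1) / 4) = -1) := by
  rw [frobeniusTrace_eq hp2 hD]
  have h4 := mod_four_of_prime_eq hp2 hx
  have hm1 := quadraticChar_neg_one_eq_one h4
  have hF : ringChar (ZMod p) ≠ 2 := by rwa [ZMod.ringChar_zmod_n]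
  have h2 : (2 : ZMod p) ≠ 0 := Ring.two_ne_zero hF
  have h11 : (1 : ZMod p) ≠ -1 := fun h' => h2 (by linear_combination h')
  by_cases hsq : IsSquare (D : ZMod p)
  · obtain ⟨t, ht⟩ := hsq
    have ht0 : t ≠ 0 := by rintro rfl; simp at ht; exact hD0 ht
    have e1 : (D : ZMod p) = 1 * t ^ 2 := by rw [ht]; ring
    have e2 : 2 * ((p - 1) / 4) = Fintype.card (ZMod p) / 2 := by rw [ZMod.card]; omega
    have e3 : (1 * t ^ 2) ^ ((p - 1) / 4) = (quadraticChar (ZMod p) t : ZMod p) := by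
      rw [quadraticChar_eq_pow_of_char_ne_two' hF, ← e2, one_mul, pow_mul]
    rw [e1, cubicCharSum_mul_sq _ ht0, cubicCharSum_one_eq hp2 hx, e3]
    rcases quadraticChar_dichotomy ht0 with h | h <;> rw [h] <;> simp [h11, h11.symm]
  · have hq : (Fintype.card (ZMod p) : ℤ) ≡ 1 [ZMOD 4] := by
      rw [ZMod.card]; unfold Int.ModEq; omega
    have h := cubicCharSum_modEq_of_not_isSquare h2 hm1 hq hsq
    have e2 : (D : ZMod p) ^ (((p - 1) / 4) * 2) = -1 := by
      have := quadraticChar_eq_pow_of_char_ne_two' hF (D : ZMod p)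
      rw [quadraticChar_neg_one_iff_not_isSquare.mpr hsq, ZMod.card] at this
      rw [show (p - 1) / 4 * 2 = p / 2 by omega, ← this]; simp
    rw [pow_mul] at e2
    unfold Int.ModEq at h
    refine ⟨⟨fun h' => by omega, fun h' => ?_⟩, ⟨fun h' => by omega, fun h' => ?_⟩⟩
    · rw [h'] at e2; simp at e2; exact absurd e2 h11
    · rw [h'] at e2; simp at e2; exact absurd e2 h11

end Trace

/-! ### Fourth roots of unity -/

/-- The ring homomorphism from the Gaussian integers that sends `i` to a square root `r` of `-1`. -/
def gaussEval {R : Type*} [CommRing R] (r : R) (hr : r * r = -1) : GaussianInt →+* R :=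
  Zsqrtd.lift ⟨r, by simpa using hr⟩

section FourthRoots

variable {R : Type*} [CommRing R]

lemma gaussEval_apply (r : R) (hr : r * r = -1) (z : GaussianInt) :
    gaussEval r hr z = z.re + z.im * r := rfl

lemma gaussEval_I (r : R) (hr : r * r = -1) : gaussEval r hr ⟨0, 1⟩ = r := by
  simp [gaussEval_apply]

lemma gaussianInt_I_mul_I : (⟨0, 1⟩ : GaussianInt) * ⟨0, 1⟩ = -1 := by decide

lemma eq_or_of_pow_four_eq_one [IsDomain R] {r z : R} (hr : r * r = -1) (hz : z ^ 4 = 1) :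
    z = 1 ∨ z = -1 ∨ z = r ∨ z = -r := by
  have h : (z - 1) * (z + 1) * ((z - r) * (z + r)) = 0 := by
    linear_combination hz - (z ^ 2 - 1) * hr
  rcases mul_eq_zero.mp h with h | h <;> rcases mul_eq_zero.mp h with h | h
  · exact Or.inl (by linear_combination h)
  · exact Or.inr (Or.inl (by linear_combination h))
  · exact Or.inr (Or.inr (Or.inl (by linear_combination h)))
  · exact Or.inr (Or.inr (Or.inr (by linear_combination h)))

lemma gaussEval_eq_one_iff [IsDomain R] {r : R} (hr : r * r = -1) (h2 : (2 : R) ≠ 0)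
    {z : GaussianInt} (hz : z ^ 4 = 1) : gaussEval r hr z = 1 ↔ z = 1 := by
  have h1 : (-1 : R) ≠ 1 := fun h => h2 (by linear_combination -h)
  refine ⟨fun h => ?_, fun h => by rw [h, map_one]⟩
  rcases eq_or_of_pow_four_eq_one gaussianInt_I_mul_I hz with h' | h' | h' | h' <;>
    rw [h'] at h ⊢
  · simp at h; exact absurd h h1
  · rw [gaussEval_I] at h; rw [h] at hr; exact absurd (by simpa using hr) h1.symm
  · rw [map_neg, gaussEval_I] at h
    have : r = -1 := by rw [← h, neg_neg]
    rw [this] at hr; exact absurd (by simpa using hr) h1.symm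

lemma gaussEval_inj [IsDomain R] {r : R} (hr : r * r = -1) (h2 : (2 : R) ≠ 0)
    {z w : GaussianInt} (hz : z ^ 4 = 1) (hw : w ^ 4 = 1)
    (h : gaussEval r hr z = gaussEval r hr w) : z = w := by
  have hzw : (z * w ^ 3) ^ 4 = 1 := by
    rw [mul_pow, hz, ← pow_mul, show 3 * 4 = 4 * 3 by rfl, pow_mul, hw]; simp
  have h1 : z * w ^ 3 = 1 := by
    rw [← gaussEval_eq_one_iff hr h2 hzw, map_mul, map_pow, h, ← map_pow, ← map_mul]
    rw [show w * w ^ 3 = w ^ 4 by ring, hw, map_one]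
  linear_combination w * h1 - z * hw

end FourthRoots

/-! ### The quartic character and its Jacobi sum -/

/-- `χ` is the quartic residue character modulo `p` attached to the square root `r` of `-1`: the
value `χ a`, a fourth root of unity in `ℤ[i]`, reduces to `a ^ ((p - 1) / 4)` under `i ↦ r`. -/
structure IsQuarticChar {p : ℕ} (χ : MulChar (ZMod p) GaussianInt) (r : ZMod p)
    (hr : r * r = -1) : Prop where
  pow_four : χ ^ 4 = 1
  eval : ∀ a, gaussEval r hr (χ a) = a ^ ((p - 1) / 4)

section QuarticChar

variable {p : ℕ} [Fact p.Prime]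

lemma exists_isQuarticChar (h4 : p % 4 = 1) {r : ZMod p} (hr : r * r = -1) :
    ∃ χ : MulChar (ZMod p) GaussianInt, IsQuarticChar χ r hr := by
  have hp1 : 1 < p := (Fact.out : p.Prime).one_lt
  obtain ⟨g, hg⟩ := IsCyclic.exists_generator (α := (ZMod p)ˣ)
  have hcard : Fintype.card (ZMod p)ˣ = p - 1 := ZMod.card_units p
  have hord : orderOf g = p - 1 := by
    rw [orderOf_eq_card_of_forall_mem_zpowers hg, Nat.card_eq_fintype_card, hcard]
  have hgu : (g : ZMod p) ^ (p - 1) = 1 := by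
    rw [← Units.val_pow_eq_pow_val, ← hord, pow_orderOf_eq_one, Units.val_one]
  have hg2 : (g : ZMod p) ^ ((p - 1) / 4 * 2) ≠ 1 := by
    intro h
    rw [← Units.val_pow_eq_pow_val, Units.val_eq_one] at h
    have := Nat.le_of_dvd (by omega) (orderOf_dvd_of_pow_eq_one h)
    omega
  have hgr : (g : ZMod p) ^ ((p - 1) / 4) = r ∨ (g : ZMod p) ^ ((p - 1) / 4) = -r := by
    have h : ((g : ZMod p) ^ ((p - 1) / 4)) ^ 4 = 1 := by
      rw [← pow_mul, show (p - 1) / 4 * 4 = p - 1 by omega, hgu]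
    rw [pow_mul] at hg2
    rcases eq_or_of_pow_four_eq_one hr h with h | h | h | h
    · rw [h] at hg2; simp at hg2
    · rw [h] at hg2; simp at hg2
    · exact Or.inl h
    · exact Or.inr h
  obtain ⟨ζ, hζ4, hζ⟩ : ∃ ζ : GaussianIntˣ, ζ ^ 4 = 1 ∧
      gaussEval r hr ζ = (g : ZMod p) ^ ((p - 1) / 4) := by
    let I : GaussianIntˣ := ⟨⟨0, 1⟩, ⟨0, -1⟩, by decide, by decide⟩
    rcases hgr with h | h
    · exact ⟨I, by ext1; decide, by rw [h]; exact gaussEval_I r hr⟩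
    · refine ⟨-I, by ext1; decide, ?_⟩
      rw [h, Units.val_neg, map_neg]; congr 1; exact gaussEval_I r hr
  have hζc : ζ ∈ rootsOfUnity (Fintype.card (ZMod p)ˣ) GaussianInt := by
    rw [mem_rootsOfUnity, hcard, show p - 1 = 4 * ((p - 1) / 4) by omega, pow_mul, hζ4, one_pow]
  refine ⟨MulChar.ofRootOfUnity hζc hg, ?_, ?_⟩
  · rw [MulChar.eq_iff hg, MulChar.pow_apply_coe, MulChar.ofRootOfUnity_spec,
      MulChar.one_apply_coe, ← Units.val_pow_eq_pow_val, hζ4, Units.val_one]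
  · intro a
    by_cases ha : a = 0
    · rw [ha, MulChar.map_zero, map_zero, zero_pow (by omega)]
    · obtain ⟨k, hk⟩ := (mem_powers_iff_mem_zpowers (x := g)).mpr (hg (Units.mk0 a ha))
      have ha' : a = (g : ZMod p) ^ k := by
        rw [← Units.val_pow_eq_pow_val, show g ^ k = Units.mk0 a ha from hk, Units.val_mk0]
      rw [ha', map_pow, MulChar.ofRootOfUnity_spec, map_pow, hζ, ← pow_mul, ← pow_mul, mul_comm]

variable {r : ZMod p} {hr : r * r = -1} {χ : MulChar (ZMod p) GaussianInt}

lemma IsQuarticChar.apply_pow_four (hχ : IsQuarticChar χ r hr) {a : ZMod p} (ha : a ≠ 0) :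
    χ a ^ 4 = 1 := by
  rw [← MulChar.pow_apply' _ (by norm_num), hχ.pow_four, MulChar.one_apply (isUnit_iff_ne_zero.mpr ha)]

lemma two_ne_zero_of_mod_four (h4 : p % 4 = 1) : (2 : ZMod p) ≠ 0 :=
  Ring.two_ne_zero (by rw [ZMod.ringChar_zmod_n]; omega)

lemma IsQuarticChar.exists_sq_eq (hχ : IsQuarticChar χ r hr) (h4 : p % 4 = 1) :
    ∃ a : ZMod p, a ≠ 0 ∧ χ a ^ 2 = -1 := by
  have hF : ringChar (ZMod p) ≠ 2 := by rw [ZMod.ringChar_zmod_n]; omega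
  obtain ⟨a, ha⟩ := quadraticChar_exists_neg_one hF
  have ha0 : a ≠ 0 := by rintro rfl; simp at ha
  refine ⟨a, ha0, gaussEval_inj hr (two_ne_zero_of_mod_four h4) ?_ (by norm_num) ?_⟩
  · rw [← pow_mul, mul_comm, pow_mul, hχ.apply_pow_four ha0, one_pow]
  · have h := quadraticChar_eq_pow_of_char_ne_two' hF a
    rw [map_pow, hχ.eval, ← pow_mul, show (p - 1) / 4 * 2 = p / 2 by omega, map_neg, map_one]
    rw [ha, ZMod.card] at h
    simpa using h.symm

/-- The norm of the Jacobi sum is `p`, as follows from the embedding of `ℤ[i]` into `ℂ`. -/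
lemma IsQuarticChar.jacobiSum_norm (hχ : IsQuarticChar χ r hr) (h4 : p % 4 = 1) :
    (jacobiSum χ χ).re ^ 2 + (jacobiSum χ χ).im ^ 2 = (p : ℤ) := by
  obtain ⟨a, ha0, ha⟩ := hχ.exists_sq_eq h4
  set χ' := χ.ringHomComp GaussianInt.toComplex with hχ'
  have ha' : χ' a ^ 2 = -1 := by
    rw [hχ', MulChar.ringHomComp_apply, ← map_pow, ha]; simp
  have hu : IsUnit a := isUnit_iff_ne_zero.mpr ha0
  have h1 : χ' ≠ 1 := by
    intro h; rw [h, MulChar.one_apply hu] at ha'; norm_num at ha'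
  have h2 : χ' * χ' ≠ 1 := by
    intro h
    rw [sq, ← MulChar.mul_apply, h, MulChar.one_apply hu] at ha'; norm_num at ha'
  have hc : ringChar ℂ ≠ ringChar (ZMod p) := by
    rw [ZMod.ringChar_zmod_n, ringChar.eq_zero]; exact (Fact.out : p.Prime).ne_zero.symm
  have h := jacobiSum_mul_jacobiSum_inv hc h1 h1 h2
  have hstar : jacobiSum χ'⁻¹ χ'⁻¹ = star (jacobiSum χ' χ') := by
    rw [← MulChar.star_eq_inv, jacobiSum, jacobiSum, star_sum]
    simp only [MulChar.star_apply, star_mul']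
  have hJ : jacobiSum χ' χ' = GaussianInt.toComplex (jacobiSum χ χ) :=
    jacobiSum_ringHomComp χ χ GaussianInt.toComplex
  rw [hstar, hJ, ZMod.card, Complex.star_def, Complex.mul_conj, ← GaussianInt.intCast_complex_norm,
    Zsqrtd.norm] at h
  have h' : (jacobiSum χ χ).re * (jacobiSum χ χ).re -
      -1 * (jacobiSum χ χ).im * (jacobiSum χ χ).im = (p : ℤ) := by exact_mod_cast h
  linear_combination h'

lemma isPrimitiveRoot_gaussianInt_I : IsPrimitiveRoot (⟨0, 1⟩ : GaussianInt) 4 := by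
  refine IsPrimitiveRoot.of_map_of_injective (f := GaussianInt.toComplex) ?_
    GaussianInt.toComplex_injective
  simpa [GaussianInt.toComplex_def] using Complex.isPrimitiveRoot_I

/-- The Jacobi sum is congruent to `-1` modulo `(i - 1) ^ 2 = -2 i`. -/
lemma IsQuarticChar.odd_re_jacobiSum (hχ : IsQuarticChar χ r hr) (h4 : p % 4 = 1) :
    Odd (jacobiSum χ χ).re := by
  obtain ⟨z, -, hz⟩ := exists_jacobiSum_eq_neg_one_add (n := 4) (by norm_num) hχ.pow_four
    hχ.pow_four (by rw [ZMod.card]; omega) isPrimitiveRoot_gaussianInt_I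
  have h : ((⟨0, 1⟩ : GaussianInt) - 1) ^ 2 = ⟨0, -2⟩ := by decide
  rw [hz, h]
  simp only [Zsqrtd.re_add, Zsqrtd.re_neg, Zsqrtd.re_one, Zsqrtd.re_mul]
  exact ⟨z.im - 1, by ring⟩

/-- The Jacobi sum reduces to `∑ a ^ m (1 - a) ^ m` with `m = (p - 1) / 4`, a sum over `ZMod p` of
the values of a polynomial of degree less than `p - 1`. -/
lemma IsQuarticChar.gaussEval_jacobiSum (hχ : IsQuarticChar χ r hr) (h4 : p % 4 = 1) :
    gaussEval r hr (jacobiSum χ χ) = 0 := by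
  have hp1 : 1 < p := (Fact.out : p.Prime).one_lt
  rw [jacobiSum, map_sum]
  have h : ∀ a : ZMod p, gaussEval r hr (χ a * χ (1 - a)) =
      ∑ j ∈ Finset.range ((p - 1) / 4 + 1), (-1) ^ j * (((p - 1) / 4).choose j : ZMod p) *
        a ^ ((p - 1) / 4 + j) := by
    intro a
    rw [map_mul, hχ.eval, hχ.eval, sub_eq_neg_add, add_pow, Finset.mul_sum]
    refine Finset.sum_congr rfl fun j _ => ?_
    rw [neg_pow, pow_add]; ring
  rw [Finset.sum_congr rfl fun a _ => h a, Finset.sum_comm]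
  refine Finset.sum_eq_zero fun j hj => ?_
  rw [Finset.mem_range] at hj
  rw [← Finset.mul_sum, FiniteField.sum_pow_lt_card_sub_one, mul_zero]
  rw [ZMod.card]; omega

end QuarticChar

section SpecialPrime

variable {p : ℕ} [Fact p.Prime] {x : ℕ}

lemma natCast_mul_self_of_prime_eq (hx : p = 1 + x ^ 2) : (x : ZMod p) * x = -1 := by
  have h : ((1 + x ^ 2 : ℕ) : ZMod p) = 0 := by rw [← hx]; simp
  push_cast at h
  linear_combination h

lemma IsQuarticChar.jacobiSum_sq {χ : MulChar (ZMod p) GaussianInt} (hp2 : p ≠ 2)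
    (hx : p = 1 + x ^ 2) (hχ : IsQuarticChar χ (x : ZMod p) (natCast_mul_self_of_prime_eq hx)) :
    jacobiSum χ χ ^ 2 = (⟨1, x⟩ : GaussianInt) ^ 2 := by
  have h4 := mod_four_of_prime_eq hp2 hx
  have hdvd : (p : ℤ) ∣ (jacobiSum χ χ).re + (jacobiSum χ χ).im * x := by
    rw [← ZMod.intCast_zmod_eq_zero_iff_dvd]
    have h := hχ.gaussEval_jacobiSum h4
    rw [gaussEval_apply] at h
    push_cast
    exact h
  have hp0 : (0 : ℤ) < p := by exact_mod_cast (Fact.out : p.Prime).pos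
  obtain ⟨h1, h2⟩ := sum_sq_eq_one_add_sq_of_dvd hp0 (x := x) (by exact_mod_cast hx)
    (by exact_mod_cast even_of_prime_eq hp2 hx) (hχ.odd_re_jacobiSum h4) (hχ.jacobiSum_norm h4) hdvd
  rcases h1 with h1 | h1
  · have : jacobiSum χ χ = ⟨1, x⟩ := by
      ext
      · exact h1
      · rw [h2, h1, one_mul]
    rw [this]
  · have : jacobiSum χ χ = -⟨1, x⟩ := by
      ext
      · exact h1
      · rw [h2, h1]; simp
    rw [this, neg_sq]

end SpecialPrime

/-! ### Gauss sums and quartic reciprocity -/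

section GaussSum

variable {p : ℕ} [Fact p.Prime] {x : ℕ} {K : Type*} [Field K] {ι : K}
  {χ : MulChar (ZMod p) GaussianInt}

lemma neg_one_ne_one_of_two_ne_zero (h2 : (2 : K) ≠ 0) : (-1 : K) ≠ 1 :=
  fun h => h2 (by linear_combination -h)

lemma IsQuarticChar.ringHomComp_ne_one {r : ZMod p} {hr : r * r = -1}
    (hχ : IsQuarticChar χ r hr) (h4 : p % 4 = 1) (h2 : (2 : K) ≠ 0) (hι : ι * ι = -1) :
    χ.ringHomComp (gaussEval ι hι) ≠ 1 ∧
      χ.ringHomComp (gaussEval ι hι) * χ.ringHomComp (gaussEval ι hι) ≠ 1 := by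
  obtain ⟨a, ha0, ha⟩ := hχ.exists_sq_eq h4
  have hu : IsUnit a := isUnit_iff_ne_zero.mpr ha0
  have ha' : χ.ringHomComp (gaussEval ι hι) a ^ 2 = -1 := by
    rw [MulChar.ringHomComp_apply, ← map_pow, ha]; simp
  refine ⟨fun h => ?_, fun h => ?_⟩
  · rw [h, MulChar.one_apply hu, one_pow] at ha'
    exact neg_one_ne_one_of_two_ne_zero h2 ha'.symm
  · rw [sq, ← MulChar.mul_apply, h, MulChar.one_apply hu] at ha'
    exact neg_one_ne_one_of_two_ne_zero h2 ha'.symm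

/-- The fourth power of the Gauss sum of the quartic character is `π ^ 2 p = π ^ 3 π'`, where
`π = 1 + x i` and `π' = 1 - x i`. -/
lemma IsQuarticChar.gaussSum_pow_four (hp2 : p ≠ 2) (hx : p = 1 + x ^ 2)
    (hχ : IsQuarticChar χ (x : ZMod p) (natCast_mul_self_of_prime_eq hx))
    (h2 : (2 : K) ≠ 0) (hι : ι * ι = -1) {ψ : AddChar (ZMod p) K} (hψ : ψ.IsPrimitive) :
    gaussSum (χ.ringHomComp (gaussEval ι hι)) ψ ^ 4 = (1 + x * ι) ^ 3 * (1 - x * ι) := by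
  have h4 := mod_four_of_prime_eq hp2 hx
  obtain ⟨-, h1⟩ := hχ.ringHomComp_ne_one h4 h2 hι
  set χ' := χ.ringHomComp (gaussEval ι hι) with hχ'
  have hJ : jacobiSum χ' χ' ^ 2 = (1 + x * ι) ^ 2 := by
    rw [hχ', jacobiSum_ringHomComp, ← map_pow, hχ.jacobiSum_sq hp2 hx, map_pow, gaussEval_apply]
    simp
  have hquad : (χ' * χ').IsQuadratic := by
    intro a
    by_cases ha : a = 0
    · left; rw [ha, MulChar.map_zero]
    · right
      have : (χ' a * χ' a) * (χ' a * χ' a) = 1 := by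
        rw [hχ', MulChar.ringHomComp_apply, ← map_mul, ← map_mul, ← map_one (gaussEval ι hι),
          ← hχ.apply_pow_four ha]
        congr 1; ring
      exact mul_self_eq_one_iff.mp this
  have hs := gaussSum_sq h1 hquad hψ
  have hm : (χ' * χ') (-1) = 1 := by
    rw [MulChar.mul_apply, ← map_mul, neg_mul_neg, one_mul, map_one]
  rw [hm, one_mul, ZMod.card] at hs
  have hmul := jacobiSum_mul_nontrivial h1 ψ
  have hpK : (p : K) = (1 + x * ι) * (1 - x * ι) := by
    rw [hx]; push_cast; linear_combination (x : K) ^ 2 * hι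
  calc gaussSum χ' ψ ^ 4 = (gaussSum χ' ψ * gaussSum χ' ψ) ^ 2 := by ring
    _ = gaussSum (χ' * χ') ψ ^ 2 * jacobiSum χ' χ' ^ 2 := by rw [← hmul]; ring
    _ = _ := by rw [hs, hJ, hpK]; ring

end GaussSum

section Reciprocity

variable {q : ℕ}

/-- `q` or `-q`, whichever is congruent to `1` modulo `4`. -/
def primaryPrime (q : ℕ) : ℤ := if q % 4 = 1 then q else -q

/-- The exponent `(q - 1) / 4` or `(q + 1) / 4`, whichever is an integer. -/
def quarticExponent (q : ℕ) : ℕ := if q % 4 = 1 then (q - 1) / 4 else (q + 1) / 4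

/-- The quotient of `1 + c i` and its conjugate `1 - c i`, in the order that makes
`quarticRatio q ι c ^ quarticExponent q` the quartic residue symbol of `1 + c i` modulo `q`. -/
def quarticRatio {K : Type*} [Field K] (q : ℕ) (ι c : K) : K :=
  if q % 4 = 1 then (1 + c * ι) / (1 - c * ι) else (1 - c * ι) / (1 + c * ι)

variable {K : Type*} [Field K] {ι : K}

lemma frob_of_mod_four_eq_one (hι : ι * ι = -1) (hq : q % 4 = 1) : ι ^ q = ι := by
  have : q = 2 * (2 * (q / 4)) + 1 := by omega
  rw [this, pow_succ, pow_mul, sq, hι, pow_mul]; simp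

lemma frob_of_mod_four_eq_three (hι : ι * ι = -1) (hq : q % 4 = 3) : ι ^ q = -ι := by
  have : q = 2 * (2 * (q / 4) + 1) + 1 := by omega
  rw [this, pow_succ, pow_mul, sq, hι, pow_succ, pow_mul]; simp

lemma two_ne_zero_of_charP [CharP K q] (hq2 : q ≠ 2) : (2 : K) ≠ 0 :=
  Ring.two_ne_zero (by rwa [ringChar.eq K q])

variable [Fact q.Prime] [CharP K q]

lemma natCast_pow_char (x : ℕ) : (x : K) ^ q = x := by
  have := map_natCast (frobenius K q) x
  rwa [frobenius_def] at this

variable {p : ℕ} [Fact p.Prime] {x : ℕ} {χ : MulChar (ZMod p) GaussianInt}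

/-- Quartic reciprocity between a prime `p = 1 + x ^ 2` and an odd prime `q`: raise the Gauss sum
of the quartic character modulo `p`, taken in characteristic `q`, to the power `q`. -/
theorem quartic_reciprocity [IsAlgClosed K] (hp2 : p ≠ 2) (hx : p = 1 + x ^ 2)
    (hχ : IsQuarticChar χ (x : ZMod p) (natCast_mul_self_of_prime_eq hx))
    (hq2 : q ≠ 2) (hpq : p ≠ q) (hι : ι * ι = -1) :
    gaussEval ι hι (χ (primaryPrime q : ZMod p)) = quarticRatio q ι (x : K) ^ quarticExponent q := by
  have hpp : p.Prime := Fact.out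
  have hqp : q.Prime := Fact.out
  have h2 : (2 : K) ≠ 0 := two_ne_zero_of_charP hq2
  have h4 := mod_four_of_prime_eq hp2 hx
  have hpK : (p : K) ≠ 0 := by
    rw [Ne, CharP.cast_eq_zero_iff K q, Nat.prime_dvd_prime_iff_eq hqp hpp]
    exact hpq.symm
  have hqu : IsUnit (q : ZMod p) := by
    rw [isUnit_iff_ne_zero, Ne, CharP.cast_eq_zero_iff (ZMod p) p,
      Nat.prime_dvd_prime_iff_eq hpp hqp]
    exact hpq
  have : NeZero (p : K) := ⟨hpK⟩
  obtain ⟨ζ, hζ⟩ := HasEnoughRootsOfUnity.exists_primitiveRoot K p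
  have hψ := AddChar.zmodChar_primitive_of_primitive_root p hζ
  set ψ := AddChar.zmodChar p ((IsPrimitiveRoot.iff_def ζ p).mp hζ).left
  obtain ⟨hne, -⟩ := hχ.ringHomComp_ne_one h4 h2 hι
  have hg4 := hχ.gaussSum_pow_four hp2 hx h2 hι hψ
  set χ' := χ.ringHomComp (gaussEval ι hι) with hχ'
  set g := gaussSum χ' ψ with hg
  have hχ4 : χ' ^ 4 = 1 := by
    rw [hχ', MulChar.ringHomComp_pow, hχ.pow_four, MulChar.ringHomComp_one]
  have hg0 : g ≠ 0 := gaussSum_ne_zero_of_nontrivial (by rwa [ZMod.card]) hne hψ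
  have hpK' : (p : K) = (1 + x * ι) * (1 - x * ι) := by
    rw [hx]; push_cast; linear_combination (x : K) ^ 2 * hι
  have hπ : 1 + x * ι ≠ 0 := left_ne_zero_of_mul (hpK' ▸ hpK)
  have hπ' : 1 - x * ι ≠ 0 := right_ne_zero_of_mul (hpK' ▸ hpK)
  have hfrob : (χ' ^ q) q * g ^ q = gaussSum (χ' ^ q) ψ := by
    rw [hg, gaussSum_frob, AddChar.pow_mulShift, ← hqu.unit_spec, gaussSum_mulShift]
  have hfrobπ : (1 + x * ι) ^ q = 1 + x * ι ^ q := by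
    rw [add_pow_char, mul_pow, one_pow, natCast_pow_char]
  have happ : ∀ a, gaussEval ι hι (χ a) = χ' a := fun a => rfl
  rw [happ]
  by_cases hq : q % 4 = 1
  · have hχq : χ' ^ q = χ' := by
      rw [show q = 4 * (q / 4) + 1 by omega, pow_succ, pow_mul, hχ4, one_pow, one_mul]
    rw [hχq, ← hg] at hfrob
    rw [frob_of_mod_four_eq_one hι hq] at hfrobπ
    simp only [primaryPrime, quarticExponent, quarticRatio, hq, if_true, Int.cast_natCast]
    obtain ⟨n, hn⟩ : ∃ n, q = 4 * n + 1 := ⟨q / 4, by omega⟩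
    rw [show (q - 1) / 4 = n by omega, div_pow, eq_div_iff (pow_ne_zero _ hπ')]
    have e1 : (1 + x * ι) ^ (4 * n) = 1 := by
      rw [hn, pow_succ] at hfrobπ
      exact mul_right_cancel₀ hπ (by rw [hfrobπ, one_mul])
    have e2 : χ' q * ((1 + x * ι) ^ 3 * (1 - x * ι)) ^ n = 1 := by
      rw [← hg4, ← pow_mul]
      apply mul_right_cancel₀ hg0
      rw [one_mul, mul_assoc, ← pow_succ, ← hn, hfrob]
    rw [mul_pow, ← pow_mul] at e2
    generalize 1 + (x : K) * ι = a at *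
    generalize 1 - (x : K) * ι = b at *
    calc χ' q * b ^ n = χ' q * b ^ n * a ^ (4 * n) := by
          rw [e1, mul_one]
      _ = (χ' q * (a ^ (3 * n) * b ^ n)) * a ^ n := by ring
      _ = _ := by rw [e2, one_mul]
  · have hq3 : q % 4 = 3 := by have := hqp.eq_two_or_odd; omega
    have hχq : χ' ^ q = χ'⁻¹ := by
      rw [eq_inv_iff_mul_eq_one, ← pow_succ, show q + 1 = 4 * (q / 4 + 1) by omega, pow_mul, hχ4,
        one_pow]
    rw [hχq] at hfrob
    rw [frob_of_mod_four_eq_three hι hq3] at hfrobπ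
    simp only [primaryPrime, quarticExponent, quarticRatio, hq, if_false, Int.cast_natCast,
      Int.cast_neg]
    obtain ⟨n, hn⟩ : ∃ n, q + 1 = 4 * n := ⟨(q + 1) / 4, by omega⟩
    rw [show (q + 1) / 4 = n by omega, div_pow, eq_div_iff (pow_ne_zero _ hπ)]
    have hχχ : χ' q * χ'⁻¹ q = 1 := by
      rw [← MulChar.mul_apply, mul_inv_cancel, MulChar.one_apply hqu]
    have e0 : g * gaussSum χ'⁻¹ ψ = χ' (-1) * p := by
      rw [← mul_gaussSum_inv_eq_gaussSum χ'⁻¹, mul_left_comm, gaussSum_mul_gaussSum_eq_card hne hψ,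
        MulChar.inv_apply', inv_neg_one, ZMod.card]
    have e2 : ((1 + x * ι) ^ 3 * (1 - x * ι)) ^ n = χ' (-q) * p := by
      rw [← hg4, ← pow_mul, ← hn, pow_succ, neg_eq_neg_one_mul, map_mul]
      linear_combination (χ' q) * e0 - g ^ q * g * hχχ + χ' q * g * hfrob
    have e1 : (1 + x * ι) ^ (4 * n) = p := by
      rw [← hn, pow_succ, hfrobπ, hpK']; ring
    have e3 : χ' (-q) * (1 + x * ι) ^ n * (1 + x * ι) ^ (3 * n) =
        (1 - x * ι) ^ n * (1 + x * ι) ^ (3 * n) := by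
      calc _ = χ' (-q) * (1 + x * ι) ^ (4 * n) := by ring
        _ = _ := by rw [e1, ← e2, mul_pow, ← pow_mul, mul_comm]
    exact mul_right_cancel₀ (pow_ne_zero _ hπ) e3

end Reciprocity

/-! ### Local quartic symbols and their moments -/

section FourthRootLift

variable {K : Type*} [Field K] {ι : K}

open Classical in
/-- The fourth root of unity in `ℤ[i]` that reduces to `z` under `i ↦ ι`; it is `0` if `z` is not
a fourth root of unity. -/
noncomputable def fourthRootLift (ι z : K) : GaussianInt :=
  if z = 1 then 1 else if z = -1 then -1 else if z = ι then ⟨0, 1⟩ else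
    if z = -ι then ⟨0, -1⟩ else 0

lemma fourthRootLift_zero (hι : ι * ι = -1) : fourthRootLift ι 0 = 0 := by
  have h : ι ≠ 0 := by rintro rfl; simp at hι
  simp [fourthRootLift, h, h.symm]

lemma gaussEval_fourthRootLift (hι : ι * ι = -1) {z : K} (hz : z ^ 4 = 1) :
    gaussEval ι hι (fourthRootLift ι z) = z := by
  unfold fourthRootLift
  split_ifs with h1 h2 h3 h4
  · rw [h1, map_one]
  · rw [h2, map_neg, map_one]
  · rw [h3, gaussEval_I]
  · simp [gaussEval_apply, h4]
  · rcases eq_or_of_pow_four_eq_one hι hz with h | h | h | h <;> contradiction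

lemma fourthRootLift_pow_four (hι : ι * ι = -1) {z : K} (hz : z ^ 4 = 1) :
    fourthRootLift ι z ^ 4 = 1 := by
  unfold fourthRootLift
  split_ifs with h1 h2 h3 h4
  · decide
  · decide
  · decide
  · decide
  · rcases eq_or_of_pow_four_eq_one hι hz with h | h | h | h <;> contradiction

lemma fourthRootLift_gaussEval (hι : ι * ι = -1) (h2 : (2 : K) ≠ 0) {w : GaussianInt}
    (hw : w ^ 4 = 1) : fourthRootLift ι (gaussEval ι hι w) = w := by
  have h : gaussEval ι hι w ^ 4 = 1 := by rw [← map_pow, hw, map_one]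
  exact gaussEval_inj hι h2 (fourthRootLift_pow_four hι h) hw (gaussEval_fourthRootLift hι h)

lemma fourthRootLift_mul (hι : ι * ι = -1) (h2 : (2 : K) ≠ 0) {z w : K} (hz : z ^ 4 = 1)
    (hw : w ^ 4 = 1) : fourthRootLift ι (z * w) = fourthRootLift ι z * fourthRootLift ι w := by
  have h := fourthRootLift_gaussEval hι h2 (w := fourthRootLift ι z * fourthRootLift ι w)
    (by rw [mul_pow, fourthRootLift_pow_four hι hz, fourthRootLift_pow_four hι hw, one_mul])
  rwa [map_mul, gaussEval_fourthRootLift hι hz, gaussEval_fourthRootLift hι hw] at h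

lemma fourthRootLift_neg_one_pow (h2 : (2 : K) ≠ 0) (n : ℕ) :
    fourthRootLift ι ((-1) ^ n) = (-1) ^ n := by
  rcases neg_one_pow_eq_or ℤ n with h | h
  · have := (neg_one_pow_eq_one_iff_even (R := ℤ) (by norm_num)).mp h
    rw [this.neg_one_pow, this.neg_one_pow, fourthRootLift, if_pos rfl]
  · have := (neg_one_pow_eq_neg_one_iff_odd (R := ℤ) (by norm_num)).mp h
    rw [this.neg_one_pow, this.neg_one_pow, fourthRootLift,
      if_neg (neg_one_ne_one_of_two_ne_zero h2), if_pos rfl]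

/-- Orthogonality for the powers of the quartic character of the group of `4 n`-th roots of
unity. -/
lemma sum_nthRootsFinset_fourthRootLift (hι : ι * ι = -1) (h2 : (2 : K) ≠ 0) {n : ℕ} (hn : 0 < n)
    {ζ : K} (hζ : IsPrimitiveRoot ζ (4 * n)) (k : ℕ) :
    ∑ u ∈ Polynomial.nthRootsFinset (4 * n) (1 : K), fourthRootLift ι (u ^ n) ^ k =
      if 4 ∣ k then (4 * n : GaussianInt) else 0 := by
  have h4 : ∀ u ∈ Polynomial.nthRootsFinset (4 * n) (1 : K), (u ^ n) ^ 4 = 1 := by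
    intro u hu
    rw [← pow_mul, mul_comm, (Polynomial.mem_nthRootsFinset (by omega) _).mp hu]
  have hζm : ζ ∈ Polynomial.nthRootsFinset (4 * n) (1 : K) :=
    (Polynomial.mem_nthRootsFinset (by omega) _).mpr hζ.pow_eq_one
  split_ifs with hk
  · obtain ⟨m, rfl⟩ := hk
    rw [Finset.sum_congr rfl (g := fun _ => 1), Finset.sum_const, hζ.card_nthRootsFinset]
    · simp
    · intro u hu
      rw [pow_mul, fourthRootLift_pow_four hι (h4 u hu), one_pow]
  · have hζ0 : ζ ≠ 0 := hζ.ne_zero (by omega)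
    have hmem : ∀ u : K, u ∈ Polynomial.nthRootsFinset (4 * n) (1 : K) ↔
        ζ * u ∈ Polynomial.nthRootsFinset (4 * n) (1 : K) := by
      intro u
      rw [Polynomial.mem_nthRootsFinset (by omega), Polynomial.mem_nthRootsFinset (by omega),
        mul_pow, hζ.pow_eq_one, one_mul]
    have hshift : ∑ u ∈ Polynomial.nthRootsFinset (4 * n) (1 : K), fourthRootLift ι (u ^ n) ^ k =
        fourthRootLift ι (ζ ^ n) ^ k *
        ∑ u ∈ Polynomial.nthRootsFinset (4 * n) (1 : K), fourthRootLift ι (u ^ n) ^ k := by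
      rw [Finset.mul_sum]
      refine (Finset.sum_equiv (Equiv.mulLeft₀ ζ hζ0) (fun u => hmem u) fun u hu => ?_).symm
      rw [Equiv.mulLeft₀_apply, mul_pow ζ, fourthRootLift_mul hι h2 (h4 ζ hζm) (h4 u hu), mul_pow]
    have hne : fourthRootLift ι (ζ ^ n) ^ k ≠ 1 := by
      intro h
      apply hk
      have h' := congrArg (gaussEval ι hι) h
      rw [map_pow, gaussEval_fourthRootLift hι (h4 ζ hζm), map_one, ← pow_mul] at h'
      have hd := hζ.dvd_of_pow_eq_one _ h'
      rw [mul_comm 4] at hd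
      exact Nat.dvd_of_mul_dvd_mul_left hn hd
    generalize (∑ u ∈ Polynomial.nthRootsFinset (4 * n) (1 : K), fourthRootLift ι (u ^ n) ^ k) = S
      at hshift
    generalize fourthRootLift ι (ζ ^ n) ^ k = a at hshift hne
    have : (a - 1) * S = 0 := by linear_combination -hshift
    exact (mul_eq_zero.mp this).resolve_left (sub_ne_zero.mpr hne)

end FourthRootLift

section Cayley

variable {q : ℕ} [Fact q.Prime] {K : Type*} [Field K] [CharP K q]

lemma exists_zmodCast_eq {c : K} (hc : c ^ q = c) : ∃ a : ZMod q, (a.cast : K) = c := by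
  have h := (Subfield.mem_bot_iff_pow_eq_self K q).mpr hc
  rw [← ZMod.fieldRange_castHom_eq_bot q] at h
  exact h

lemma zmodCast_pow_char (c : ZMod q) : (c.cast : K) ^ q = c.cast := by
  rw [← ZMod.cast_pow (dvd_refl q), ZMod.pow_card]

lemma cayley_pow_eq_one {j : K} {N : ℕ} (hNq : (q = N + 1 ∧ j ^ q = j) ∨ (q + 1 = N ∧ j ^ q = -j))
    (c : ZMod q) (ha : (1 - c.cast * j : K) ≠ 0) (hb : (1 + c.cast * j : K) ≠ 0) :
    ((1 - c.cast * j) / (1 + c.cast * j) : K) ^ N = 1 := by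
  have hadd : (1 + c.cast * j : K) ^ q = 1 + c.cast * j ^ q := by
    rw [add_pow_char, mul_pow, zmodCast_pow_char, one_pow]
  have hsub : (1 - c.cast * j : K) ^ q = 1 - c.cast * j ^ q := by
    rw [sub_pow_char, mul_pow, zmodCast_pow_char, one_pow]
  rcases hNq with ⟨hq, hjq⟩ | ⟨hq, hjq⟩
  · have h := div_pow (1 - c.cast * j) (1 + c.cast * j) q
    rw [hadd, hsub, hjq] at h
    refine mul_right_cancel₀ (div_ne_zero ha hb) ?_
    rw [one_mul, ← pow_succ, ← hq, h]
  · rw [← hq, pow_succ, div_pow, hadd, hsub, hjq]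
    have h : 1 - c.cast * -j = 1 + c.cast * j := by ring
    have h' : 1 + c.cast * -j = 1 - c.cast * j := by ring
    rw [h, h', div_mul_div_comm, mul_comm, div_self (mul_ne_zero ha hb)]

/-- The Cayley transform `c ↦ (1 - c j) / (1 + c j)` is a bijection from the residue classes with
`c ^ 2 ≠ -1` to the `N`-th roots of unity other than `-1`, where `N = q - 1` or `N = q + 1`
according as the square root `j` of `-1` lies in the prime field or not. -/
lemma sum_cayley {j : K} (hj : j * j = -1) (h2 : (2 : K) ≠ 0) {N : ℕ} (hN : 0 < N)
    (hNq : (q = N + 1 ∧ j ^ q = j) ∨ (q + 1 = N ∧ j ^ q = -j)) {A : Type*} [AddCommGroup A]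
    (f : K → A) (hf : f 0 = 0) (hN1 : (-1 : K) ^ N = 1) :
    ∑ c : ZMod q, f ((1 - c.cast * j) / (1 + c.cast * j)) =
      ∑ u ∈ Polynomial.nthRootsFinset N (1 : K), f u - f (-1) := by
  classical
  have hj0 : j ≠ 0 := by rintro rfl; simp at hj
  have hm1 : (-1 : K) ∈ Polynomial.nthRootsFinset N (1 : K) :=
    (Polynomial.mem_nthRootsFinset hN _).mpr hN1
  rw [← Finset.add_sum_erase _ _ hm1, add_sub_cancel_left]
  rw [← Finset.sum_filter_add_sum_filter_not Finset.univ
    (fun c : ZMod q => (1 - c.cast * j : K) * (1 + c.cast * j) ≠ 0)]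
  have hzero : ∑ c : ZMod q with ¬ ((1 - c.cast * j : K) * (1 + c.cast * j) ≠ 0),
      f ((1 - c.cast * j) / (1 + c.cast * j)) = 0 := by
    refine Finset.sum_eq_zero fun c hc => ?_
    rw [Finset.mem_filter, not_not, mul_eq_zero] at hc
    rw [div_eq_zero_iff.mpr hc.2, hf]
  rw [hzero, add_zero]
  refine Finset.sum_bij (fun c _ => (1 - c.cast * j) / (1 + c.cast * j)) ?_ ?_ ?_ ?_
  · intro c hc
    rw [Finset.mem_filter] at hc
    have ha := left_ne_zero_of_mul hc.2
    have hb := right_ne_zero_of_mul hc.2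
    rw [Finset.mem_erase, Polynomial.mem_nthRootsFinset hN]
    refine ⟨fun h => ?_, ?_⟩
    · rw [div_eq_iff hb] at h
      exact h2 (by linear_combination h)
    · exact cayley_pow_eq_one hNq c ha hb
  · intro c hc d hd h
    rw [Finset.mem_filter] at hc hd
    have hb := right_ne_zero_of_mul hc.2
    have hb' := right_ne_zero_of_mul hd.2
    rw [div_eq_div_iff hb hb'] at h
    have h3 : (2 * j) * ((d.cast : K) - c.cast) = 0 := by linear_combination h
    have h4 := (mul_eq_zero.mp h3).resolve_left (mul_ne_zero h2 hj0)
    exact (ZMod.castHom (dvd_refl q) K).injective (sub_eq_zero.mp h4).symm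
  · intro u hu
    rw [Finset.mem_erase, Polynomial.mem_nthRootsFinset hN] at hu
    obtain ⟨hu1, huN⟩ := hu
    have hu1' : 1 + u ≠ 0 := fun h => hu1 (by linear_combination h)
    have hu0 : u ≠ 0 := by rintro rfl; rw [zero_pow hN.ne'] at huN; exact zero_ne_one huN
    have hc : ((1 - u) / (j * (1 + u))) ^ q = (1 - u) / (j * (1 + u)) := by
      rw [div_pow, mul_pow, sub_pow_char, add_pow_char, one_pow]
      rcases hNq with ⟨hq, hjq⟩ | ⟨hq, hjq⟩
      · have : u ^ q = u := by rw [hq, pow_succ, huN, one_mul]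
        rw [hjq, this]
      · have h : u ^ q * u = 1 := by rw [← pow_succ, hq, huN]
        have h' : u ^ q = u⁻¹ := eq_inv_of_mul_eq_one_left h
        have h3 : 1 + u⁻¹ ≠ 0 := by
          intro h4; apply hu1'
          field_simp at h4
          linear_combination h4
        rw [hjq, h', div_eq_div_iff (mul_ne_zero (neg_ne_zero.mpr hj0) h3) (mul_ne_zero hj0 hu1')]
        field_simp
        ring
    obtain ⟨c, hc'⟩ := exists_zmodCast_eq hc
    have e1 : (1 - c.cast * j : K) = 2 * u / (1 + u) := by rw [hc']; field_simp; ring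
    have e2 : (1 + c.cast * j : K) = 2 / (1 + u) := by rw [hc']; field_simp; ring
    refine ⟨c, ?_, ?_⟩
    · rw [Finset.mem_filter, e1, e2]
      exact ⟨Finset.mem_univ _, mul_ne_zero (div_ne_zero (mul_ne_zero h2 hu0) hu1')
        (div_ne_zero h2 hu1')⟩
    · rw [e1, e2]; field_simp
  · intro c _; rfl

end Cayley

lemma sum_range_natCast_zmod {A : Type*} [AddCommMonoid A] (m : ℕ) [NeZero m] (f : ZMod m → A) :
    ∑ c ∈ Finset.range m, f (c : ZMod m) = ∑ c : ZMod m, f c := by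
  refine Finset.sum_bij' (fun c _ => (c : ZMod m)) (fun c _ => c.val) ?_ ?_ ?_ ?_ ?_
  · intro c _; exact Finset.mem_univ _
  · intro c _; exact Finset.mem_range.mpr (ZMod.val_lt c)
  · intro c hc; exact ZMod.val_cast_of_lt (Finset.mem_range.mp hc)
  · intro c _; exact ZMod.natCast_zmod_val c
  · intro c _; rfl

/-- The properties of the function `F` expressing the quartic character of `± q` modulo a prime
`p = 1 + x ^ 2` through the residue class of `x` modulo `q`. -/
structure IsLocalSymbol (q : ℕ) (F : ℕ → GaussianInt) : Prop where
  periodic : ∀ c, F (c + q) = F c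
  eq_zero : ∀ c, q ∣ 1 + c ^ 2 → F c = 0
  pow_four : ∀ c, ¬ q ∣ 1 + c ^ 2 → F c ^ 4 = 1
  sum_pow : ∀ k, 0 < k → ∑ c ∈ Finset.range q, F c ^ k =
    (if 4 ∣ k then (4 * quarticExponent q : GaussianInt) else 0) - ((-1) ^ quarticExponent q) ^ k
  reciprocity : ∀ (p x : ℕ) [Fact p.Prime] (hx : p = 1 + x ^ 2) (χ : MulChar (ZMod p) GaussianInt),
    IsQuarticChar χ (x : ZMod p) (natCast_mul_self_of_prime_eq hx) → p ≠ 2 → p ≠ q →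
      χ (primaryPrime q : ZMod p) = F x

/-- The symbol is `quarticRatio q ι c ^ quarticExponent q` over an algebraic closure of the prime
field, lifted to `ℤ[i]`; at `c ^ 2 = -1` either the numerator or the denominator of the ratio
vanishes, and the quotient is `0` in both cases. -/
theorem exists_isLocalSymbol {q : ℕ} (hq : q.Prime) (hq2 : q ≠ 2) : ∃ F, IsLocalSymbol q F := by
  have : Fact q.Prime := ⟨hq⟩
  set K := AlgebraicClosure (ZMod q)
  have hchar : CharP K q := charP_of_injective_algebraMap (algebraMap (ZMod q) K).injective q
  obtain ⟨ι, hι'⟩ := IsAlgClosed.exists_pow_nat_eq (-1 : K) (n := 2) two_pos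
  have hι : ι * ι = -1 := by rw [← sq, hι']
  have h2 : (2 : K) ≠ 0 := two_ne_zero_of_charP hq2
  obtain ⟨j, hj, hratio, hNq⟩ : ∃ j : K, j * j = -1 ∧
      (∀ c : K, quarticRatio q ι c = (1 - c * j) / (1 + c * j)) ∧
      ((q = 4 * quarticExponent q + 1 ∧ j ^ q = j) ∨
        (q + 1 = 4 * quarticExponent q ∧ j ^ q = -j)) := by
    by_cases h : q % 4 = 1
    · refine ⟨-ι, by rw [neg_mul_neg, hι], fun c => ?_, Or.inl ⟨?_, ?_⟩⟩
      · rw [quarticRatio, if_pos h]; congr 1 <;> ring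
      · rw [quarticExponent, if_pos h]; omega
      · rw [Odd.neg_pow (hq.odd_of_ne_two hq2), frob_of_mod_four_eq_one hι h]
    · have h3 : q % 4 = 3 := by have := hq.eq_two_or_odd; omega
      refine ⟨ι, hι, fun c => ?_, Or.inr ⟨?_, frob_of_mod_four_eq_three hι h3⟩⟩
      · rw [quarticRatio, if_neg h]
      · rw [quarticExponent, if_neg h]; omega
  set n := quarticExponent q with hn
  have hq3 : 3 ≤ q := by have := hq.two_le; omega
  have hn0 : 0 < n := by rcases hNq with ⟨h, -⟩ | ⟨h, -⟩ <;> omega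
  have hnK : ((4 * n : ℕ) : K) ≠ 0 := by
    rcases hNq with ⟨h, -⟩ | ⟨h, -⟩
    · have := congrArg (Nat.cast (R := K)) h
      rw [Nat.cast_succ, CharP.cast_eq_zero K q] at this
      intro h0; rw [h0, zero_add] at this; exact zero_ne_one this
    · rw [← h, Nat.cast_succ, CharP.cast_eq_zero K q, zero_add]; exact one_ne_zero
  have : NeZero ((4 * n : ℕ) : K) := ⟨hnK⟩
  obtain ⟨ζ, hζ⟩ := HasEnoughRootsOfUnity.exists_primitiveRoot K (4 * n)
  have hcast : ∀ c : ℕ, ((c : ZMod q).cast : K) = c := fun c => ZMod.cast_natCast (dvd_refl q) c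
  have hprod : ∀ c : ℕ, (1 - (c : K) * j) * (1 + (c : K) * j) = ((1 + c ^ 2 : ℕ) : K) := by
    intro c; push_cast; linear_combination -(c : K) ^ 2 * hj
  refine ⟨fun c => fourthRootLift ι (quarticRatio q ι (c : K) ^ n), ?_, ?_, ?_, ?_, ?_⟩
  · intro c
    simp
  · intro c hc
    have h0 := hprod c
    rw [(CharP.cast_eq_zero_iff K q _).mpr hc, mul_eq_zero] at h0
    rw [hratio, div_eq_zero_iff.mpr h0, zero_pow hn0.ne', fourthRootLift_zero hι]
  · intro c hc
    have h0 : (1 - (c : K) * j) * (1 + (c : K) * j) ≠ 0 := by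
      rwa [hprod, Ne, CharP.cast_eq_zero_iff K q]
    apply fourthRootLift_pow_four hι
    have h := cayley_pow_eq_one hNq (c : ZMod q) (by rw [hcast]; exact left_ne_zero_of_mul h0)
      (by rw [hcast]; exact right_ne_zero_of_mul h0)
    rw [hcast] at h
    rw [hratio, ← pow_mul, mul_comm n, h]
  · intro k hk
    have h := sum_cayley (A := GaussianInt) hj h2 (N := 4 * n) (by omega) hNq
      (fun u => fourthRootLift ι (u ^ n) ^ k)
      (by rw [zero_pow hn0.ne', fourthRootLift_zero hι, zero_pow hk.ne'])
      (by rw [pow_mul]; norm_num)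
    beta_reduce at h
    rw [sum_nthRootsFinset_fourthRootLift hι h2 hn0 hζ, fourthRootLift_neg_one_pow h2] at h
    rw [← h, ← sum_range_natCast_zmod]
    exact Finset.sum_congr rfl fun c _ => by rw [hcast, hratio]
  · intro p x hp hx χ hχ hp2 hpq
    have h := quartic_reciprocity hp2 hx hχ hq2 hpq hι
    rw [← h, fourthRootLift_gaussEval hι h2]
    apply hχ.apply_pow_four
    have hpp : p.Prime := Fact.out
    have hqp : (q : ZMod p) ≠ 0 := by
      rw [Ne, CharP.cast_eq_zero_iff (ZMod p) p, Nat.prime_dvd_prime_iff_eq hpp hq]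
      exact hpq
    unfold primaryPrime
    split_ifs <;> simpa using hqp

/-! ### Sums of periodic functions -/

lemma periodic_mod {A : Type*} {m : ℕ} {f : ℕ → A} (hf : ∀ c, f (c + m) = f c) (c : ℕ) :
    f (c % m) = f c :=
  Function.Periodic.map_mod_nat (f := f) hf c

lemma sum_range_mul_of_periodic {A : Type*} [CommSemiring A] {m n : ℕ} (hm : 0 < m) (hn : 0 < n)
    (h : m.Coprime n) {f g : ℕ → A} (hf : ∀ c, f (c + m) = f c) (hg : ∀ c, g (c + n) = g c) :
    ∑ c ∈ Finset.range (m * n), f c * g c =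
      (∑ c ∈ Finset.range m, f c) * ∑ c ∈ Finset.range n, g c := by
  rw [Finset.sum_mul_sum, ← Finset.sum_product']
  refine Finset.sum_bij' (fun c _ => (c % m, c % n))
    (fun a _ => (Nat.chineseRemainder h a.1 a.2 : ℕ)) ?_ ?_ ?_ ?_ ?_
  · intro c _
    simp [Nat.mod_lt _ hm, Nat.mod_lt _ hn]
  · intro a _
    exact Finset.mem_range.mpr (Nat.chineseRemainder_lt_mul h _ _ hm.ne' hn.ne')
  · intro c hc
    have hk := Nat.chineseRemainder_modEq_unique h (a := c % m) (b := c % n) (z := c)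
      (Nat.mod_modEq c m).symm (Nat.mod_modEq c n).symm
    have h1 := Nat.mod_eq_of_lt (Nat.chineseRemainder_lt_mul h (c % m) (c % n) hm.ne' hn.ne')
    rw [← h1, ← hk, Nat.mod_eq_of_lt (Finset.mem_range.mp hc)]
  · intro a ha
    simp only [Finset.mem_product, Finset.mem_range] at ha
    have h1 : _ % m = _ % m := (Nat.chineseRemainder h a.1 a.2).2.1
    have h2 : _ % n = _ % n := (Nat.chineseRemainder h a.1 a.2).2.2
    ext
    · simp only []; rw [h1, Nat.mod_eq_of_lt ha.1]
    · simp only []; rw [h2, Nat.mod_eq_of_lt ha.2]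
  · intro c _
    simp only [periodic_mod hf, periodic_mod hg]

lemma periodic_of_dvd {A : Type*} {m n : ℕ} {f : ℕ → A} (hf : ∀ c, f (c + m) = f c) (h : m ∣ n)
    (c : ℕ) : f (c + n) = f c := by
  obtain ⟨k, rfl⟩ := h
  rw [mul_comm]
  exact Function.Periodic.nat_mul (f := f) hf k c

/-- The Chinese remainder theorem for sums of products of periodic functions with coprime periods. -/
lemma sum_range_prod_of_periodic {A : Type*} [CommSemiring A] {m : ℕ} (hm : 0 < m) {g : ℕ → A}
    (hg : ∀ c, g (c + m) = g c) (S : Finset ℕ) (hS : ∀ q ∈ S, q.Prime) (hSm : ∀ q ∈ S, q.Coprime m)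
    {f : ℕ → ℕ → A} (hf : ∀ q ∈ S, ∀ c, f q (c + q) = f q c) :
    ∑ c ∈ Finset.range (m * ∏ q ∈ S, q), g c * ∏ q ∈ S, f q c =
      (∑ c ∈ Finset.range m, g c) * ∏ q ∈ S, ∑ c ∈ Finset.range q, f q c := by
  induction S using Finset.induction_on with
  | empty => simp
  | insert q S hq ih =>
    have ih' := ih (fun l hl => hS l (Finset.mem_insert_of_mem hl))
      (fun l hl => hSm l (Finset.mem_insert_of_mem hl))
      (fun l hl => hf l (Finset.mem_insert_of_mem hl))
    have hqp := hS q (Finset.mem_insert_self _ _)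
    have hpos : 0 < m * ∏ l ∈ S, l := Nat.mul_pos hm
      (Finset.prod_pos fun l hl => (hS l (Finset.mem_insert_of_mem hl)).pos)
    have hcop : (m * ∏ l ∈ S, l).Coprime q := by
      refine Nat.Coprime.mul_left (hSm q (Finset.mem_insert_self _ _)).symm ?_
      refine Nat.Coprime.prod_left fun l hl => ?_
      refine (Nat.coprime_primes (hS l (Finset.mem_insert_of_mem hl)) hqp).mpr ?_
      rintro rfl; exact hq hl
    have hper : ∀ c, g (c + m * ∏ l ∈ S, l) * ∏ l ∈ S, f l (c + m * ∏ l ∈ S, l) =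
        g c * ∏ l ∈ S, f l c := by
      intro c
      rw [periodic_of_dvd hg (dvd_mul_right _ _)]
      congr 1
      refine Finset.prod_congr rfl fun l hl => ?_
      exact periodic_of_dvd (hf l (Finset.mem_insert_of_mem hl))
        ((Finset.dvd_prod_of_mem _ hl).mul_left _) c
    rw [Finset.prod_insert hq, Finset.prod_insert hq, mul_comm q, ← mul_assoc,
      mul_comm (∑ c ∈ Finset.range q, f q c), ← mul_assoc, ← ih',
      ← sum_range_mul_of_periodic hpos hqp.pos hcop hper (hf q (Finset.mem_insert_self _ _))]
    refine Finset.sum_congr rfl fun c _ => ?_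
    rw [Finset.prod_insert hq]; ring

/-! ### The supplementary laws -/

lemma sub_one_div_four_eq {p x y : ℕ} (hx : p = 1 + x ^ 2) (hy : x = 2 * y) : (p - 1) / 4 = y ^ 2 := by
  rw [hx, hy, mul_pow, Nat.add_sub_cancel_left]; omega

section Supplement

variable {p : ℕ} [Fact p.Prime] {x : ℕ} {χ : MulChar (ZMod p) GaussianInt}

lemma IsQuarticChar.apply_neg_one (hp2 : p ≠ 2) (hx : p = 1 + x ^ 2)
    (hχ : IsQuarticChar χ (x : ZMod p) (natCast_mul_self_of_prime_eq hx)) :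
    χ (-1) = (-1) ^ (x / 2) := by
  obtain ⟨y, hy⟩ := even_iff_two_dvd.mp (even_of_prime_eq hp2 hx)
  apply gaussEval_inj (natCast_mul_self_of_prime_eq hx)
    (two_ne_zero_of_mod_four (mod_four_of_prime_eq hp2 hx))
  · exact hχ.apply_pow_four (by simp)
  · rw [← pow_mul, mul_comm, pow_mul]; norm_num
  · rw [hχ.eval, sub_one_div_four_eq hx hy, map_pow, map_neg, map_one, hy,
      Nat.mul_div_cancel_left _ two_pos, sq, pow_mul]
    rcases Nat.even_or_odd y with h | h
    · rw [h.neg_one_pow, one_pow]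
    · rw [h.neg_one_pow, h.neg_one_pow]

/-- Since `(1 + x) ^ 2 = 2 x` modulo `p`, the quartic character of `2` is determined by that of `x`
and by the Legendre symbol of `1 + x`, which is the Jacobi symbol `(2 / (1 + x))`. -/
lemma IsQuarticChar.apply_two (hp2 : p ≠ 2) (hx : p = 1 + x ^ 2)
    (hχ : IsQuarticChar χ (x : ZMod p) (natCast_mul_self_of_prime_eq hx)) :
    χ 2 = ⟨0, 1⟩ ^ (x / 2) := by
  have h4 := mod_four_of_prime_eq hp2 hx
  have hr := natCast_mul_self_of_prime_eq hx
  have h2 := two_ne_zero_of_mod_four h4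
  obtain ⟨y, hy⟩ := even_iff_two_dvd.mp (even_of_prime_eq hp2 hx)
  have hm := sub_one_div_four_eq hx hy
  have hleg : legendreSym p (1 + x : ℕ) = ZMod.χ₈ (1 + x : ℕ) := by
    have hodd : Odd (1 + x) := ⟨y, by omega⟩
    rw [jacobiSym.legendreSym.to_jacobiSym, jacobiSym.quadratic_reciprocity_one_mod_four' hodd h4,
      ← jacobiSym.at_two hodd]
    apply jacobiSym.mod_left'
    rw [← Int.ModEq, Int.modEq_iff_dvd]
    exact ⟨1 - x, by rw [hx]; push_cast; ring⟩
  have hpow : ((1 + x : ℕ) : ZMod p) ^ (p / 2) = ((ZMod.χ₈ (1 + x : ℕ) : ℤ) : ZMod p) := by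
    rw [← hleg, legendreSym.eq_pow]; simp
  have hsq : ((1 + x : ℕ) : ZMod p) ^ 2 = 2 * x := by push_cast; linear_combination hr
  apply gaussEval_inj hr h2
  · exact hχ.apply_pow_four h2
  · rw [← pow_mul, mul_comm, pow_mul, show (⟨0, 1⟩ : GaussianInt) ^ 4 = 1 by decide, one_pow]
  · rw [hχ.eval, map_pow, gaussEval_I, hm]
    have hx0 : (x : ZMod p) ≠ 0 := by
      intro h; rw [h] at hr; simp at hr
    apply mul_right_cancel₀ (pow_ne_zero (y ^ 2) hx0)
    rw [← mul_pow, ← hsq, ← pow_mul, show 2 * y ^ 2 = p / 2 by omega, hpow,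
      ZMod.χ₈_nat_eq_if_mod_eight, hy, Nat.mul_div_cancel_left _ two_pos, ← pow_add]
    have hz : (x : ZMod p) ^ 4 = 1 := by
      calc (x : ZMod p) ^ 4 = (x * x) ^ 2 := by ring
        _ = 1 := by rw [hr]; norm_num
    rw [← hy]
    obtain ⟨k, hk⟩ : ∃ k, y = 4 * k ∨ y = 4 * k + 1 ∨ y = 4 * k + 2 ∨ y = 4 * k + 3 :=
      ⟨y / 4, by omega⟩
    have hz2 : (x : ZMod p) ^ 2 = -1 := by rw [sq, hr]
    rcases hk with rfl | rfl | rfl | rfl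
    · rw [if_neg (by omega), if_pos (by omega),
        show 4 * k + (4 * k) ^ 2 = 4 * (k + 4 * k ^ 2) by ring, pow_mul, hz]; simp
    · rw [if_neg (by omega), if_neg (by omega),
        show 4 * k + 1 + (4 * k + 1) ^ 2 = 4 * (3 * k + 4 * k ^ 2) + 2 by ring, pow_add, pow_mul,
        hz, hz2]; simp
    · rw [if_neg (by omega), if_neg (by omega),
        show 4 * k + 2 + (4 * k + 2) ^ 2 = 4 * (5 * k + 4 * k ^ 2 + 1) + 2 by ring, pow_add,
        pow_mul, hz, hz2]; simp
    · rw [if_neg (by omega), if_pos (by omega),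
        show 4 * k + 3 + (4 * k + 3) ^ 2 = 4 * (7 * k + 4 * k ^ 2 + 3) by ring, pow_mul, hz]; simp

end Supplement

/-! ### Equidistribution of the primes `1 + x ^ 2` in residue classes -/

/-- The natural numbers `x` for which `1 + x ^ 2` is a prime at most `N`. -/
def primeArgs (N : ℕ) : Finset ℕ :=
  (Finset.range (N + 1)).filter fun x => (1 + x ^ 2).Prime ∧ 1 + x ^ 2 ≤ N

/-- The residue classes `c` modulo `M` for which `1 + c ^ 2` is prime to `M`. -/
def admissibleClasses (M : ℕ) : Finset ℕ :=
  (Finset.range M).filter fun c => (1 + c ^ 2).Coprime M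

lemma mem_primeArgs {N x : ℕ} : x ∈ primeArgs N ↔ (1 + x ^ 2).Prime ∧ 1 + x ^ 2 ≤ N := by
  rw [primeArgs, Finset.mem_filter, Finset.mem_range, and_iff_right_iff_imp]
  rintro ⟨-, h⟩
  nlinarith

lemma one_add_sq_injective : Function.Injective fun x : ℕ => 1 + x ^ 2 := by
  intro a b h
  exact Nat.pow_left_injective two_ne_zero (Nat.add_left_cancel h)

lemma ncard_primesOfForm_and (N : ℕ) (G : ℕ → Prop) [DecidablePred G] :
    {p : ℕ | p ∈ primesOfForm 1 N ∧ G p}.ncard =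
      ((primeArgs N).filter fun x => G (1 + x ^ 2)).card := by
  rw [← Finset.card_image_of_injective _ one_add_sq_injective, ← Set.ncard_coe_finset]
  congr 1
  ext p
  simp only [primesOfForm, Set.mem_ofPred_eq, Finset.coe_image, Finset.coe_filter, Set.mem_image,
    mem_primeArgs]
  constructor
  · rintro ⟨⟨hp, hN, x, hx⟩, hG⟩
    have hp' : 1 + x.natAbs ^ 2 = p := by
      zify
      rw [hx, sq_abs]; ring
    exact ⟨x.natAbs, by rw [hp']; exact ⟨⟨hp, hN⟩, hG⟩, hp'⟩
  · rintro ⟨x, ⟨⟨hp, hN⟩, hG⟩, rfl⟩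
    exact ⟨⟨hp, hN, x, by push_cast; ring⟩, hG⟩

lemma quadraticPrimeCount_eq {M c : ℕ} (hc : c < M) (N : ℕ) :
    quadraticPrimeCount ((M : ℤ) ^ 2) (2 * M * c) ((c : ℤ) ^ 2 + 1) (N + 1) =
      ((primeArgs N).filter fun x => x % M = c).card := by
  rw [← Finset.card_image_of_injective _ one_add_sq_injective, ← Set.ncard_coe_finset,
    quadraticPrimeCount]
  congr 1
  ext p
  simp only [Set.mem_ofPred_eq, Finset.coe_image, Finset.coe_filter, Set.mem_image, mem_primeArgs]
  constructor
  · rintro ⟨hp, hN, x, hx⟩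
    have hp' : 1 + (M * x + c) ^ 2 = p := by
      zify
      rw [hx]; ring
    refine ⟨M * x + c, ⟨by rw [hp']; exact ⟨hp, by omega⟩, ?_⟩, hp'⟩
    rw [Nat.mul_add_mod, Nat.mod_eq_of_lt hc]
  · rintro ⟨x, ⟨⟨hp, hN⟩, hx⟩, rfl⟩
    refine ⟨hp, by omega, x / M, ?_⟩
    have h : (x : ℤ) = M * (x / M : ℕ) + c := by
      rw [← hx]; exact_mod_cast (Nat.div_add_mod x M).symm
    push_cast at h ⊢
    nth_rewrite 1 [h]; ring

/-- The Hardy-Littlewood constant of `(M y + c) ^ 2 + 1` does not depend on `c`: the discriminant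
is `-4 M ^ 2`, and the primes dividing the two leading coefficients are those dividing `M`. -/
lemma isHardyLittlewoodConstant_class {M : ℕ} (hM : Even M) {c c' : ℕ} {δ : ℝ}
    (h : IsHardyLittlewoodConstant ((M : ℤ) ^ 2) (2 * M * c) ((c : ℤ) ^ 2 + 1) δ) :
    IsHardyLittlewoodConstant ((M : ℤ) ^ 2) (2 * M * c') ((c' : ℤ) ^ 2 + 1) δ := by
  have hgcd : ∀ d : ℕ, Int.gcd 2 ((M : ℤ) ^ 2 + 2 * M * d) = 2 := by
    intro d
    obtain ⟨m, hm⟩ := hM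
    refine Int.gcd_eq_natAbs_left_iff_dvd.mpr ?_
    exact ⟨2 * m ^ 2 + M * d, by rw [hm]; push_cast; ring⟩
  have hcf : ∀ d : ℕ, commonFactorProduct ((M : ℤ) ^ 2) (2 * M * d) =
      ∏ p ∈ ((M : ℤ) ^ 2).natAbs.primeFactors.filter (fun p : ℕ => 2 < p),
        (p : ℝ) / ((p : ℝ) - 1) := by
    intro d
    rw [commonFactorProduct]
    congr 1
    refine Finset.filter_congr fun p hp => and_iff_left ?_
    have hp1 := Nat.prime_of_mem_primeFactors hp
    have hp2 := Nat.dvd_of_mem_primeFactors hp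
    rw [Int.natAbs_pow, Int.natAbs_natCast] at hp2
    have hp3 : (p : ℤ) ∣ M := by exact_mod_cast hp1.dvd_of_dvd_pow hp2
    exact (hp3.mul_left 2).mul_right _
  have hsp : ∀ d : ℕ, (2 * (M : ℤ) * d) ^ 2 - 4 * (M : ℤ) ^ 2 * ((d : ℤ) ^ 2 + 1) =
      -4 * (M : ℤ) ^ 2 := by intro d; ring
  unfold IsHardyLittlewoodConstant singularPartialProduct at *
  simpa only [hgcd, hcf, hsp] using h

lemma tendsto_sqrt_div_log : Tendsto (fun n : ℕ => √(n : ℝ) / Real.log n) atTop atTop := by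
  have h := (isLittleO_log_rpow_atTop (r := 1 / 2) (by norm_num)).tendsto_div_nhds_zero
  have h' : Tendsto (fun x : ℝ => Real.log x / x ^ (1 / 2 : ℝ)) atTop (𝓝[>] 0) := by
    rw [tendsto_nhdsWithin_iff]
    refine ⟨h, ?_⟩
    filter_upwards [eventually_gt_atTop 1] with x hx
    exact div_pos (Real.log_pos hx) (Real.rpow_pos_of_pos (by linarith) _)
  refine ((tendsto_inv_nhdsGT_zero.comp h').comp tendsto_natCast_atTop_atTop).congr fun n => ?_
  simp only [Function.comp_apply, inv_div, Real.sqrt_eq_rpow]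

/-- A function asymptotic to `0 * f` vanishes eventually. -/
lemma ne_zero_of_isEquivalent_of_one_le {u : ℕ → ℝ} {δ : ℝ}
    (h : u ~[atTop] fun n : ℕ => δ * (√(n : ℝ) / Real.log n)) (hu : ∀ᶠ n in atTop, 1 ≤ u n) :
    δ ≠ 0 := by
  rintro rfl
  have h0 : u =ᶠ[atTop] 0 := by
    rw [← isEquivalent_zero_iff_eventually_zero]
    refine h.trans ?_
    simp only [zero_mul]
    rfl
  obtain ⟨n, h1, h2⟩ := (h0.and hu).exists
  rw [h1] at h2
  norm_num at h2

lemma tendsto_div_of_isEquivalent {u f : ℕ → ℝ} {δ : ℝ} (hf : Tendsto f atTop atTop)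
    (h : u ~[atTop] fun n => δ * f n) : Tendsto (fun n => u n / f n) atTop (𝓝 δ) := by
  have h1 : (fun n => u n / f n) ~[atTop] fun n => δ * f n / f n := h.div IsEquivalent.refl
  have h2 : (fun n => δ * f n / f n) =ᶠ[atTop] fun _ => δ := by
    filter_upwards [hf.eventually_gt_atTop 0] with n hn
    rw [mul_div_cancel_right₀ _ hn.ne']
  exact ((h1.congr_right h2).symm.tendsto_nhds tendsto_const_nhds)

lemma not_isSquare_neg_four_mul_sq {m : ℤ} (hm : m ≠ 0) : ¬ IsSquare (-4 * m ^ 2) := by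
  rintro ⟨a, ha⟩
  have : 0 < m ^ 2 := by positivity
  nlinarith [mul_self_nonneg a]

/-- The conjecture for `x ^ 2 + 1` alone provides infinitely many primes of this form: the constant
is not zero, since there is at least one such prime. -/
lemma exists_prime_one_add_sq (hHL : HardyLittlewoodConjecture) (B : ℕ) :
    ∃ x : ℕ, (1 + x ^ 2).Prime ∧ B < 1 + x ^ 2 := by
  obtain ⟨δ, -, h⟩ := hHL 1 0 1 one_pos (by decide) (by decide)
    (not_isSquare_neg_four_mul_sq (m := 1) one_ne_zero)
  have hδ : δ ≠ 0 := by
    refine ne_zero_of_isEquivalent_of_one_le h ?_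
    filter_upwards [eventually_ge_atTop 3] with n hn
    have : 0 < quadraticPrimeCount 1 0 1 n := by
      refine (Set.ncard_pos ((Set.finite_lt_nat n).subset fun p hp => hp.2.1)).mpr ?_
      exact ⟨2, Nat.prime_two, by omega, 1, by norm_num⟩
    exact_mod_cast this
  by_contra! hB
  have hbound : ∀ n, (quadraticPrimeCount 1 0 1 n : ℝ) ≤ (B + 1 : ℕ) := by
    intro n
    have hsub : {p : ℕ | p.Prime ∧ p < n ∧ ∃ x : ℕ, (p : ℤ) = 1 * (x : ℤ) ^ 2 + 0 * (x : ℤ) + 1} ⊆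
        (Finset.range (B + 1) : Set ℕ) := by
      rintro p ⟨hp, -, x, hx⟩
      have hp' : p = 1 + x ^ 2 := by zify; rw [hx]; ring
      have := hB x (hp' ▸ hp)
      simp only [Finset.coe_range, Set.mem_Iio]
      omega
    have := Set.ncard_le_ncard hsub (Finset.finite_toSet _)
    rw [Set.ncard_coe_finset, Finset.card_range] at this
    rw [quadraticPrimeCount]
    exact_mod_cast this
  have hlim := tendsto_div_of_isEquivalent tendsto_sqrt_div_log h
  have hlim0 : Tendsto (fun n : ℕ => (quadraticPrimeCount 1 0 1 n : ℝ) / (√(n : ℝ) / Real.log n))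
      atTop (𝓝 0) := by
    refine squeeze_zero' (g := fun n : ℕ => ((B + 1 : ℕ) : ℝ) / (√(n : ℝ) / Real.log n)) ?_ ?_
      (tendsto_const_nhds.div_atTop tendsto_sqrt_div_log)
    · filter_upwards [tendsto_sqrt_div_log.eventually_gt_atTop 0] with n hn
      positivity
    · filter_upwards [tendsto_sqrt_div_log.eventually_gt_atTop 0] with n hn
      exact div_le_div_of_nonneg_right (hbound n) hn.le
  exact hδ (tendsto_nhds_unique hlim hlim0)

lemma coprime_mod_iff (x M : ℕ) : (1 + (x % M) ^ 2).Coprime M ↔ (1 + x ^ 2).Coprime M := by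
  have h : 1 + (x % M) ^ 2 ≡ 1 + x ^ 2 [MOD M] := ((Nat.mod_modEq x M).pow 2).add_left 1
  rw [Nat.coprime_iff_gcd_eq_one, Nat.coprime_iff_gcd_eq_one, h.gcd_eq]

/-- Under the conjecture the primes `1 + x ^ 2` are equidistributed in the admissible residue
classes of `x` modulo `M`. -/
lemma exists_tendsto_class (hHL : HardyLittlewoodConjecture) {M : ℕ} (hM : Even M) (hM0 : 0 < M) :
    ∃ δ : ℝ, δ ≠ 0 ∧ ∀ c ∈ admissibleClasses M,
      Tendsto (fun N : ℕ => (((primeArgs N).filter fun x => x % M = c).card : ℝ) /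
        (√((N + 1 : ℕ) : ℝ) / Real.log (N + 1 : ℕ))) atTop (𝓝 δ) := by
  have hclass : ∀ c ∈ admissibleClasses M, ∃ δ : ℝ,
      IsHardyLittlewoodConstant ((M : ℤ) ^ 2) (2 * M * c) ((c : ℤ) ^ 2 + 1) δ ∧
      (fun n : ℕ => (quadraticPrimeCount ((M : ℤ) ^ 2) (2 * M * c) ((c : ℤ) ^ 2 + 1) n : ℝ))
        ~[atTop] fun n : ℕ => δ * (√(n : ℝ) / Real.log n) := by
    intro c hc
    have hcop := (Finset.mem_filter.mp hc).2
    apply hHL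
    · positivity
    · have hco : IsCoprime ((c : ℤ) ^ 2 + 1) (M : ℤ) := by
        have := Nat.isCoprime_iff_coprime.mpr hcop
        push_cast at this
        rwa [add_comm]
      rw [← Int.isCoprime_iff_gcd_eq_one]
      exact (hco.symm.pow_left (m := 2)).of_isCoprime_of_dvd_left (Int.gcd_dvd_left _ _)
    · rintro ⟨-, he⟩
      have h2 : 2 ∣ 1 + c ^ 2 := by
        have := he.two_dvd
        rw [add_comm] at this
        exact_mod_cast this
      exact Nat.not_coprime_of_dvd_of_dvd one_lt_two h2 hM.two_dvd hcop
    · rw [show (2 * (M : ℤ) * c) ^ 2 - 4 * (M : ℤ) ^ 2 * ((c : ℤ) ^ 2 + 1) =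
        -4 * (M : ℤ) ^ 2 by ring]
      exact not_isSquare_neg_four_mul_sq (by positivity)
  obtain ⟨x, hx, hxM⟩ := exists_prime_one_add_sq hHL M
  have hx0 : x % M ∈ admissibleClasses M := by
    rw [admissibleClasses, Finset.mem_filter, Finset.mem_range, coprime_mod_iff]
    refine ⟨Nat.mod_lt _ hM0, (Nat.Prime.coprime_iff_not_dvd hx).mpr fun h => ?_⟩
    exact absurd (Nat.le_of_dvd hM0 h) (by omega)
  obtain ⟨δ, hδ, hδc⟩ := hclass _ hx0
  refine ⟨δ, ?_, ?_⟩
  · refine ne_zero_of_isEquivalent_of_one_le hδc ?_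
    filter_upwards [eventually_ge_atTop (1 + x ^ 2 + 1)] with n hn
    obtain ⟨N, rfl⟩ : ∃ N, n = N + 1 := ⟨n - 1, by omega⟩
    rw [quadraticPrimeCount_eq (Nat.mod_lt _ hM0)]
    have : 0 < ((primeArgs N).filter fun y => y % M = x % M).card :=
      Finset.card_pos.mpr ⟨x, Finset.mem_filter.mpr ⟨mem_primeArgs.mpr ⟨hx, by omega⟩, rfl⟩⟩
    exact_mod_cast this
  · intro c hc
    obtain ⟨δ', hδ', hc'⟩ := hclass c hc
    have heq : δ' = δ := tendsto_nhds_unique hδ' (isHardyLittlewoodConstant_class hM hδ)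
    subst heq
    have h := (tendsto_div_of_isEquivalent tendsto_sqrt_div_log hc').comp (tendsto_add_atTop_nat 1)
    refine h.congr fun N => ?_
    simp only [Function.comp_apply]
    rw [quadraticPrimeCount_eq (Finset.mem_range.mp (Finset.mem_filter.mp hc).1)]

lemma tendsto_sqrt_div_log_succ :
    Tendsto (fun N : ℕ => √((N + 1 : ℕ) : ℝ) / Real.log (N + 1 : ℕ)) atTop atTop :=
  tendsto_sqrt_div_log.comp (tendsto_add_atTop_nat 1)

/-- A property of primes that is given, up to finitely many exceptions, by the membership of
`x mod M` in a set `S` of admissible classes, has a density among the primes `1 + x ^ 2`. -/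
theorem tendsto_density (hHL : HardyLittlewoodConjecture) {M : ℕ} (hM : Even M) (hM0 : 0 < M)
    {S : Finset ℕ} (hS : S ⊆ admissibleClasses M) {G : ℕ → Prop} (B : ℕ)
    (hG : ∀ x : ℕ, (1 + x ^ 2).Prime → B < 1 + x ^ 2 → (G (1 + x ^ 2) ↔ x % M ∈ S)) :
    Tendsto (fun N : ℕ => ({p : ℕ | p ∈ primesOfForm 1 N ∧ G p}.ncard : ℝ) /
      ((primesOfForm 1 N).ncard : ℝ)) atTop (𝓝 ((S.card : ℝ) / (admissibleClasses M).card)) := by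
  classical
  obtain ⟨δ, hδ, hlim⟩ := exists_tendsto_class hHL hM hM0
  set f : ℕ → ℝ := fun N => √((N + 1 : ℕ) : ℝ) / Real.log (N + 1 : ℕ) with hf
  have key : ∀ (T : Finset ℕ), T ⊆ admissibleClasses M → ∀ (H : ℕ → Prop) (C : ℕ),
      (∀ x : ℕ, (1 + x ^ 2).Prime → C < 1 + x ^ 2 → (H (1 + x ^ 2) ↔ x % M ∈ T)) →
      Tendsto (fun N : ℕ => ({p : ℕ | p ∈ primesOfForm 1 N ∧ H p}.ncard : ℝ) / f N) atTop
        (𝓝 (T.card * δ)) := by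
    intro T hT H C hH
    have hmain : Tendsto (fun N : ℕ =>
        ∑ c ∈ T, (((primeArgs N).filter fun x => x % M = c).card : ℝ) / f N) atTop
        (𝓝 (T.card * δ)) := by
      rw [← nsmul_eq_mul, ← Finset.sum_const]
      exact tendsto_finsetSum _ fun c hc => hlim c (hT hc)
    have herr : Tendsto (fun N : ℕ => ({p : ℕ | p ∈ primesOfForm 1 N ∧ H p}.ncard : ℝ) / f N -
        ∑ c ∈ T, (((primeArgs N).filter fun x => x % M = c).card : ℝ) / f N) atTop (𝓝 0) := by
      refine squeeze_zero_norm' (a := fun N => ((C + 1 : ℕ) : ℝ) / f N) ?_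
        (tendsto_const_nhds.div_atTop tendsto_sqrt_div_log_succ)
      filter_upwards [tendsto_sqrt_div_log_succ.eventually_gt_atTop 0] with N hN
      rw [← Finset.sum_div, ← sub_div, norm_div, Real.norm_of_nonneg hN.le]
      refine div_le_div_of_nonneg_right ?_ hN.le
      have h1 : ∑ c ∈ T, (((primeArgs N).filter fun x => x % M = c).card : ℝ) =
          (((primeArgs N).filter fun x => x % M ∈ T).card : ℝ) := by
        rw [Finset.card_eq_sum_card_fiberwise
          (s := (primeArgs N).filter fun x => x % M ∈ T) (f := fun x => x % M) (t := T)
          (fun x hx => (Finset.mem_filter.mp hx).2), Nat.cast_sum]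
        refine Finset.sum_congr rfl fun c hc => ?_
        rw [Finset.filter_filter]
        congr 2
        refine Finset.filter_congr fun x _ => ?_
        exact ⟨fun h => ⟨h ▸ hc, h⟩, fun h => h.2⟩
      rw [h1, ncard_primesOfForm_and]
      -- The two sets agree outside the arguments `x` with `1 + x ^ 2 ≤ C`.
      have hsub : ∀ U V : Finset ℕ, (∀ x ∈ U, x ∉ V → x ∈ Finset.range (C + 1)) →
          (U.card : ℝ) ≤ V.card + (C + 1 : ℕ) := by
        intro U V h
        have : U ⊆ V ∪ Finset.range (C + 1) := by
          intro x hx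
          by_cases hV : x ∈ V
          · exact Finset.mem_union_left _ hV
          · exact Finset.mem_union_right _ (h x hx hV)
        have := (Finset.card_le_card this).trans (Finset.card_union_le _ _)
        rw [Finset.card_range] at this
        exact_mod_cast this
      have hsmall : ∀ x : ℕ, x ∈ primeArgs N → ¬ (H (1 + x ^ 2) ↔ x % M ∈ T) →
          x ∈ Finset.range (C + 1) := by
        intro x hx hne
        rw [Finset.mem_range]
        by_contra hlt
        exact hne (hH x (mem_primeArgs.mp hx).1 (by nlinarith))
      rw [Real.norm_eq_abs, abs_le]
      constructor
      · have := hsub ((primeArgs N).filter fun x => x % M ∈ T)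
          ((primeArgs N).filter fun x => H (1 + x ^ 2)) (by
            intro x hx hx'
            rw [Finset.mem_filter] at hx hx'
            exact hsmall x hx.1 fun h => hx' ⟨hx.1, h.mpr hx.2⟩)
        linarith
      · have := hsub ((primeArgs N).filter fun x => H (1 + x ^ 2))
          ((primeArgs N).filter fun x => x % M ∈ T) (by
            intro x hx hx'
            rw [Finset.mem_filter] at hx hx'
            exact hsmall x hx.1 fun h => hx' ⟨hx.1, h.mp hx.2⟩)
        linarith
    simpa using herr.add hmain
  have hA : (admissibleClasses M).card ≠ 0 := by
    obtain ⟨x, hx, hxM⟩ := exists_prime_one_add_sq hHL M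
    refine Finset.card_ne_zero_of_mem (a := x % M) ?_
    rw [admissibleClasses, Finset.mem_filter, Finset.mem_range, coprime_mod_iff]
    refine ⟨Nat.mod_lt _ hM0, (Nat.Prime.coprime_iff_not_dvd hx).mpr fun h => ?_⟩
    exact absurd (Nat.le_of_dvd hM0 h) (by omega)
  have hnum := key S hS G B hG
  have hden := key (admissibleClasses M) subset_rfl (fun _ => True) M (by
    intro x hx hxM
    rw [admissibleClasses, Finset.mem_filter, Finset.mem_range, coprime_mod_iff, true_iff]
    refine ⟨Nat.mod_lt _ hM0, (Nat.Prime.coprime_iff_not_dvd hx).mpr fun h => ?_⟩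
    exact absurd (Nat.le_of_dvd hM0 h) (by omega))
  have hA' : ((admissibleClasses M).card : ℝ) ≠ 0 := by exact_mod_cast hA
  have h := hnum.div hden (mul_ne_zero hA' hδ)
  rw [mul_div_mul_right _ _ hδ] at h
  refine h.congr' ?_
  filter_upwards [tendsto_sqrt_div_log_succ.eventually_gt_atTop 0] with N hN
  simp only [and_true, Set.ofPred_mem_eq, Pi.div_apply]
  rw [div_div_div_cancel_right₀ hN.ne']

/-! ### The quartic character of `D` as a periodic function, and its moments -/

/-- The contribution of the unit and of the powers of `2`: the quartic character of `± 2 ^ σ`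
modulo `1 + x ^ 2` is `w ^ (x / 2)`, where `w = ± i ^ σ`. -/
def twoSymbol (w : GaussianInt) (c : ℕ) : GaussianInt := if c % 2 = 0 then w ^ (c / 2) else 0

/-- The sum of the `k`-th powers of a local symbol at `q` over the residue classes modulo `q`. -/
def localMoment (q k : ℕ) : ℤ :=
  (if 4 ∣ k then 4 * (quarticExponent q : ℤ) else 0) - ((-1) ^ quarticExponent q) ^ k

lemma twoSymbol_periodic {w : GaussianInt} (hw : w ^ 4 = 1) (c : ℕ) :
    twoSymbol w (c + 8) = twoSymbol w c := by
  unfold twoSymbol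
  rw [show (c + 8) % 2 = c % 2 by omega, show (c + 8) / 2 = c / 2 + 4 by omega, pow_add, hw,
    mul_one]

lemma sum_twoSymbol_pow {w : GaussianInt} (hw : w ^ 4 = 1) {k : ℕ} (hk : 0 < k) :
    ∑ c ∈ Finset.range 8, twoSymbol w c ^ k = if w ^ k = 1 then 4 else 0 := by
  have h : ∑ c ∈ Finset.range 8, twoSymbol w c ^ k =
      1 + w ^ k + (w ^ k) ^ 2 + (w ^ k) ^ 3 := by
    simp [Finset.sum_range_succ, twoSymbol, hk.ne']
    ring
  rw [h]
  have hz : (w ^ k) ^ 4 = 1 := by rw [← pow_mul, mul_comm, pow_mul, hw, one_pow]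
  rcases eq_or_of_pow_four_eq_one gaussianInt_I_mul_I hz with h' | h' | h' | h' <;> rw [h'] <;>
    decide

/-- Orthogonality on the group of fourth roots of unity. -/
lemma four_mul_card_filter_eq (s : Finset ℕ) {T : ℕ → GaussianInt}
    (hT : ∀ c ∈ s, T c = 0 ∨ T c ^ 4 = 1) {ζ : GaussianInt} (hζ : ζ = 1 ∨ ζ = -1) :
    4 * ((s.filter fun c => T c = ζ).card : GaussianInt) =
      ∑ c ∈ s, T c ^ 4 + ζ * ∑ c ∈ s, T c ^ 3 + ∑ c ∈ s, T c ^ 2 + ζ * ∑ c ∈ s, T c ^ 1 := by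
  rw [Finset.card_filter, Nat.cast_sum, Finset.mul_sum, Finset.mul_sum, Finset.mul_sum,
    ← Finset.sum_add_distrib, ← Finset.sum_add_distrib, ← Finset.sum_add_distrib]
  refine Finset.sum_congr rfl fun c hc => ?_
  rcases hT c hc with h | h
  · rw [h]; rcases hζ with rfl | rfl <;> decide
  · rcases eq_or_of_pow_four_eq_one gaussianInt_I_mul_I h with h' | h' | h' | h' <;> rw [h'] <;>
      rcases hζ with rfl | rfl <;> decide

section Global

variable {S : Finset ℕ} {e : ℕ → ℕ} {F : ℕ → ℕ → GaussianInt} {w : GaussianInt}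

/-- The quartic character of `± 2 ^ σ ∏ q ^ e_q` modulo a prime `1 + x ^ 2`, as a function of the
residue class of `x`. It vanishes at the classes that are not admissible. -/
def globalSymbol (w : GaussianInt) (S : Finset ℕ) (e : ℕ → ℕ) (F : ℕ → ℕ → GaussianInt) (c : ℕ) :
    GaussianInt :=
  twoSymbol w c * ∏ q ∈ S, F q c ^ e q

lemma globalSymbol_periodic (hw : w ^ 4 = 1) (hF : ∀ q ∈ S, IsLocalSymbol q (F q)) (c : ℕ) :
    globalSymbol w S e F (c + 8 * ∏ q ∈ S, q) = globalSymbol w S e F c := by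
  unfold globalSymbol
  rw [periodic_of_dvd (twoSymbol_periodic hw) (dvd_mul_right _ _)]
  congr 1
  refine Finset.prod_congr rfl fun q hq => ?_
  rw [periodic_of_dvd (hF q hq).periodic ((Finset.dvd_prod_of_mem _ hq).mul_left _)]

lemma globalSymbol_of_coprime (hw : w ^ 4 = 1) (hS : ∀ q ∈ S, q.Prime)
    (hF : ∀ q ∈ S, IsLocalSymbol q (F q)) {c : ℕ} (hc : (1 + c ^ 2).Coprime (8 * ∏ q ∈ S, q)) :
    globalSymbol w S e F c ^ 4 = 1 := by
  have h2 : c % 2 = 0 := by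
    by_contra h
    have hodd : Odd c := Nat.odd_iff.mpr (by omega)
    have hd : 2 ∣ 1 + c ^ 2 := (Odd.add_odd odd_one hodd.pow).two_dvd
    exact Nat.not_coprime_of_dvd_of_dvd one_lt_two hd (Dvd.intro (4 * ∏ q ∈ S, q) (by ring)) hc
  rw [globalSymbol, twoSymbol, if_pos h2, mul_pow, ← pow_mul, mul_comm (c / 2), pow_mul, hw, one_pow,
    one_mul, ← Finset.prod_pow]
  refine Finset.prod_eq_one fun q hq => ?_
  rw [← pow_mul, mul_comm (e q), pow_mul, (hF q hq).pow_four, one_pow]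
  intro hd
  exact Nat.not_coprime_of_dvd_of_dvd (hS q hq).one_lt hd
    ((Finset.dvd_prod_of_mem _ hq).mul_left _) hc

lemma globalSymbol_of_not_coprime (hS : ∀ q ∈ S, q.Prime) (he : ∀ q ∈ S, 0 < e q)
    (hF : ∀ q ∈ S, IsLocalSymbol q (F q)) {c : ℕ}
    (hc : ¬ (1 + c ^ 2).Coprime (8 * ∏ q ∈ S, q)) : globalSymbol w S e F c = 0 := by
  rw [globalSymbol]
  by_cases h2 : c % 2 = 0
  · obtain ⟨l, hl, hl1, hl2⟩ := Nat.Prime.not_coprime_iff_dvd.mp hc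
    have hl8 : ¬ l ∣ 8 := by
      intro h
      have : l = 2 := (Nat.prime_dvd_prime_iff_eq hl Nat.prime_two).mp
        (hl.dvd_of_dvd_pow (show l ∣ 2 ^ 3 from h))
      subst this
      have : (2 : ℕ) ∣ c ^ 2 := (Nat.dvd_of_mod_eq_zero h2).pow two_ne_zero
      omega
    obtain ⟨q, hq, hlq⟩ := (Prime.dvd_finsetProd_iff hl.prime _).mp
      ((hl.dvd_mul.mp hl2).resolve_left hl8)
    rw [(Nat.prime_dvd_prime_iff_eq hl (hS q hq)).mp hlq] at hl1
    rw [Finset.prod_eq_zero hq, mul_zero]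
    rw [(hF q hq).eq_zero c hl1, zero_pow (he q hq).ne']
  · rw [twoSymbol, if_neg h2, zero_mul]

lemma sum_globalSymbol_pow (hw : w ^ 4 = 1) (hS : ∀ q ∈ S, q.Prime ∧ q ≠ 2)
    (he : ∀ q ∈ S, 0 < e q) (hF : ∀ q ∈ S, IsLocalSymbol q (F q)) {k : ℕ} (hk : 0 < k) :
    ∑ c ∈ Finset.range (8 * ∏ q ∈ S, q), globalSymbol w S e F c ^ k =
      (((if w ^ k = 1 then 4 else 0) * ∏ q ∈ S, localMoment q (e q * k) : ℤ) : GaussianInt) := by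
  have h := sum_range_prod_of_periodic (A := GaussianInt) (m := 8) (by norm_num)
    (g := fun c => twoSymbol w c ^ k) (fun c => by simp only [twoSymbol_periodic hw]) S
    (fun q hq => (hS q hq).1)
    (fun q hq => Nat.Coprime.pow_right 3
      (((Nat.coprime_primes (hS q hq).1 Nat.prime_two)).mpr (hS q hq).2))
    (f := fun q c => F q c ^ (e q * k)) (fun q hq c => by simp only [(hF q hq).periodic])
  have hl : ∀ c, globalSymbol w S e F c ^ k = twoSymbol w c ^ k * ∏ q ∈ S, F q c ^ (e q * k) := by
    intro c
    rw [globalSymbol, mul_pow, ← Finset.prod_pow]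
    congr 1
    exact Finset.prod_congr rfl fun q _ => by rw [pow_mul]
  rw [Finset.sum_congr rfl fun c _ => hl c, h, sum_twoSymbol_pow hw hk]
  push_cast
  congr 1
  refine Finset.prod_congr rfl fun q hq => ?_
  rw [(hF q hq).sum_pow _ (Nat.mul_pos (he q hq) hk), localMoment]
  push_cast
  rfl

/-- Quartic reciprocity and its supplements, assembled: the quartic character of `D` modulo
`p = 1 + x ^ 2` is the global symbol at `x`. -/
lemma quarticChar_eq_globalSymbol {p x : ℕ} [Fact p.Prime] (hp2 : p ≠ 2) (hx : p = 1 + x ^ 2)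
    {χ : MulChar (ZMod p) GaussianInt}
    (hχ : IsQuarticChar χ (x : ZMod p) (natCast_mul_self_of_prime_eq hx))
    (hF : ∀ q ∈ S, IsLocalSymbol q (F q)) (hpS : ∀ q ∈ S, p ≠ q) {a : ℤ} (ha : a = 1 ∨ a = -1)
    (σ : ℕ) :
    χ ((a * 2 ^ σ * ∏ q ∈ S, primaryPrime q ^ e q : ℤ) : ZMod p) =
      globalSymbol (a * ⟨0, 1⟩ ^ σ) S e F x := by
  have h2 : x % 2 = 0 := Nat.even_iff.mp (even_of_prime_eq hp2 hx)
  rw [globalSymbol, twoSymbol, if_pos h2]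
  push_cast
  rw [map_mul, map_mul, map_pow, map_prod, hχ.apply_two hp2 hx, mul_pow, pow_right_comm]
  congr 1
  · congr 1
    rcases ha with rfl | rfl
    · simp
    · push_cast; exact hχ.apply_neg_one hp2 hx
  · refine Finset.prod_congr rfl fun q hq => ?_
    rw [map_pow, (hF q hq).reciprocity p x hx χ hχ hp2 (hpS q hq)]

end Global

lemma curve_Δ (D : ℤ) : (curve D).Δ = -64 * D ^ 3 := by
  simp [curve, WeierstrassCurve.Δ, WeierstrassCurve.b₂, WeierstrassCurve.b₄, WeierstrassCurve.b₆,
    WeierstrassCurve.b₈]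
  ring

/-- The density for `a_p = 2 ζ`, where `ζ = ± 1`, in terms of the moments `μ k`: the sum over the
classes modulo `M = 8 ∏ q` of the `k`-th powers of the quartic character of `D`. In particular
`μ 4` is the number of admissible classes. -/
theorem hasTraceDensity_of_factorization (hHL : HardyLittlewoodConjecture) {S : Finset ℕ}
    (hS : ∀ q ∈ S, q.Prime ∧ q ≠ 2) {e : ℕ → ℕ} (he : ∀ q ∈ S, 0 < e q) {a : ℤ}
    (ha : a = 1 ∨ a = -1) {σ : ℕ} {D : ℤ} (hD : D = a * 2 ^ σ * ∏ q ∈ S, primaryPrime q ^ e q)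
    {w : GaussianInt} (hw : w = a * ⟨0, 1⟩ ^ σ) {μ : ℕ → ℤ}
    (hμ : ∀ k, μ k = (if w ^ k = 1 then 4 else 0) * ∏ q ∈ S, localMoment q (e q * k))
    {ζ : ℤ} (hζ : ζ = 1 ∨ ζ = -1) :
    HasTraceDensity D ζ (((μ 4 + ζ * μ 3 + μ 2 + ζ * μ 1 : ℤ) : ℝ) / (4 * μ 4)) := by
  have hw4 : w ^ 4 = 1 := by
    rw [hw, mul_pow, ← pow_mul, mul_comm σ, pow_mul, show (⟨0, 1⟩ : GaussianInt) ^ 4 = 1 by decide,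
      one_pow, mul_one]
    rcases ha with rfl | rfl <;> norm_num
  have hex : ∀ q, ∃ F, q ∈ S → IsLocalSymbol q F := by
    intro q
    by_cases hq : q ∈ S
    · obtain ⟨F, hF⟩ := exists_isLocalSymbol (hS q hq).1 (hS q hq).2
      exact ⟨F, fun _ => hF⟩
    · exact ⟨fun _ => 0, fun h => absurd h hq⟩
  choose F hF using hex
  have hSp : ∀ q ∈ S, q.Prime := fun q hq => (hS q hq).1
  set M := 8 * ∏ q ∈ S, q with hM
  set T := globalSymbol w S e F with hT
  have hM0 : 0 < M := Nat.mul_pos (by norm_num) (Finset.prod_pos fun q hq => (hSp q hq).pos)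
  have hMe : Even M := even_iff_two_dvd.mpr (Dvd.intro (4 * ∏ q ∈ S, q) (by rw [hM]; ring))
  have hper : ∀ c, T (c + M) = T c := globalSymbol_periodic hw4 hF
  have hmom : ∀ k, 0 < k → ∑ c ∈ Finset.range M, T c ^ k = ((μ k : ℤ) : GaussianInt) := by
    intro k hk
    rw [hμ]; exact sum_globalSymbol_pow hw4 hS he hF hk
  have hT0 : ∀ c ∈ Finset.range M, T c = 0 ∨ T c ^ 4 = 1 := by
    intro c _
    by_cases hc : (1 + c ^ 2).Coprime M
    · exact Or.inr (globalSymbol_of_coprime hw4 hSp hF hc)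
    · exact Or.inl (globalSymbol_of_not_coprime hSp he hF hc)
  have hζ' : (ζ : GaussianInt) = 1 ∨ (ζ : GaussianInt) = -1 := by
    rcases hζ with rfl | rfl <;> simp
  set R := (Finset.range M).filter fun c => T c = (ζ : GaussianInt) with hR
  have hcardR : 4 * (R.card : ℤ) = μ 4 + ζ * μ 3 + μ 2 + ζ * μ 1 := by
    have h := four_mul_card_filter_eq (Finset.range M) hT0 hζ'
    rw [hmom 4 (by norm_num), hmom 3 (by norm_num), hmom 2 (by norm_num), hmom 1 (by norm_num)] at h
    apply Int.cast_injective (α := GaussianInt)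
    push_cast
    exact h
  have hcardA : ((admissibleClasses M).card : ℤ) = μ 4 := by
    apply Int.cast_injective (α := GaussianInt)
    rw [← hmom 4 (by norm_num), admissibleClasses, Finset.card_filter]
    push_cast
    refine Finset.sum_congr rfl fun c _ => ?_
    by_cases hc : (1 + c ^ 2).Coprime M
    · rw [if_pos hc, hT, globalSymbol_of_coprime hw4 hSp hF hc]
    · rw [if_neg hc, hT, globalSymbol_of_not_coprime hSp he hF hc, zero_pow (by norm_num)]
  have hRA : R ⊆ admissibleClasses M := by
    intro c hc
    rw [hR, Finset.mem_filter] at hc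
    refine Finset.mem_filter.mpr ⟨hc.1, ?_⟩
    by_contra hcop
    have h0 : T c = 0 := globalSymbol_of_not_coprime hSp he hF hcop
    rw [h0] at hc
    rcases hζ' with h | h <;> rw [h] at hc <;> exact absurd hc.2 (by decide)
  have hD0 : D ≠ 0 := by
    rw [hD]
    refine mul_ne_zero (mul_ne_zero (by rcases ha with rfl | rfl <;> norm_num) (by norm_num))
      (Finset.prod_ne_zero_iff.mpr fun q hq => pow_ne_zero _ ?_)
    have := (hSp q hq).ne_zero
    unfold primaryPrime
    split_ifs <;> simpa using this
  have hform : primesOfForm ζ = primesOfForm 1 := by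
    funext N
    unfold primesOfForm
    rcases hζ with rfl | rfl <;> norm_num
  have hdens := tendsto_density hHL hMe hM0 hRA
    (G := fun p => ¬ (p : ℤ) ∣ (curve D).Δ ∧ frobeniusTrace D p = 2 * ζ)
    ((curve D).Δ.natAbs + D.natAbs + M + 2) ?_
  · unfold HasTraceDensity
    rw [hform]
    convert hdens using 2
    have h1 : ((μ 4 + ζ * μ 3 + μ 2 + ζ * μ 1 : ℤ) : ℝ) = 4 * (R.card : ℝ) := by
      rw [← hcardR]; push_cast; ring
    have h2 : ((μ 4 : ℤ) : ℝ) = ((admissibleClasses M).card : ℝ) := by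
      rw [← hcardA]; push_cast; ring
    rw [h1, h2, mul_div_mul_left _ _ (by norm_num : (4 : ℝ) ≠ 0)]
  · intro x hxp hxB
    obtain ⟨p, hx⟩ : ∃ p, p = 1 + x ^ 2 := ⟨_, rfl⟩
    rw [← hx] at hxp hxB ⊢
    have : Fact p.Prime := ⟨hxp⟩
    have hp2 : p ≠ 2 := by omega
    have hndvd : ∀ z : ℤ, z ≠ 0 → z.natAbs < p → ¬ (p : ℤ) ∣ z := by
      intro z hz hlt hdvd
      have := Nat.le_of_dvd (Int.natAbs_pos.mpr hz) (Int.natCast_dvd.mp hdvd)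
      omega
    have hΔ : ¬ (p : ℤ) ∣ (curve D).Δ := by
      refine hndvd _ ?_ (by omega)
      rw [curve_Δ]; exact mul_ne_zero (by norm_num) (pow_ne_zero 3 hD0)
    have hDp : (D : ZMod p) ≠ 0 := by
      rw [Ne, ZMod.intCast_zmod_eq_zero_iff_dvd]
      exact hndvd _ hD0 (by omega)
    have hpS : ∀ q ∈ S, p ≠ q := by
      rintro q hq rfl
      have := Nat.le_of_dvd hM0 ((Finset.dvd_prod_of_mem (fun q => q) hq).mul_left 8)
      omega
    have h4 := mod_four_of_prime_eq hp2 hx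
    have h2 := two_ne_zero_of_mod_four h4
    have hr := natCast_mul_self_of_prime_eq hx
    obtain ⟨χ, hχ⟩ := exists_isQuarticChar h4 hr
    have hχD : χ (D : ZMod p) = T x := by
      rw [hD, quarticChar_eq_globalSymbol hp2 hx hχ hF hpS ha σ, hT, hw]
    have htr := frobeniusTrace_eq_iff hp2 hx hΔ hDp
    rw [← hχ.eval, hχD] at htr
    have hTx4 : T x ^ 4 = 1 := by rw [← hχD]; exact hχ.apply_pow_four hDp
    rw [hR, Finset.mem_filter, Finset.mem_range, periodic_mod hper]
    simp only [hΔ, not_false_eq_true, true_and, Nat.mod_lt _ hM0]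
    have hinj : ∀ z : GaussianInt, z ^ 4 = 1 → (gaussEval _ hr (T x) = gaussEval _ hr z ↔ T x = z) :=
      fun z hz => ⟨gaussEval_inj hr h2 hTx4 hz, fun h => by rw [h]⟩
    rcases hζ with rfl | rfl
    · have h := hinj 1 (by norm_num)
      rw [map_one] at h
      rw [mul_one, htr.1, h, Int.cast_one]
    · have h := hinj (-1) (by norm_num)
      rw [map_neg, map_one] at h
      rw [show (2 : ℤ) * -1 = -2 by norm_num, htr.2, h, Int.cast_neg, Int.cast_one]

/-! ### Evaluation of the moments -/

/-- The value of `τ` at an odd prime. -/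
def tauPrime (q : ℕ) : ℕ := if q % 4 = 1 then q - 2 else q

lemma tauPrime_ne_zero {q : ℕ} (hq : q.Prime) : tauPrime q ≠ 0 := by
  have := hq.two_le
  unfold tauPrime
  split_ifs <;> omega

lemma factorization_prod_primes {S : Finset ℕ} (hS : ∀ q ∈ S, q.Prime) {l : ℕ} (hl : l ∈ S) :
    (∏ q ∈ S, q).factorization l = 1 := by
  rw [Nat.factorization_prod_apply (fun q hq => (hS q hq).ne_zero),
    Finset.sum_eq_single_of_mem l hl, (hS l hl).factorization_self]
  intro q hq hql
  rw [(hS q hq).factorization, Finsupp.single_eq_of_ne hql.symm]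

lemma tau_prod_primes {S : Finset ℕ} (hS : ∀ q ∈ S, q.Prime) :
    tau (∏ q ∈ S, q) = ∏ q ∈ S, tauPrime q := by
  rw [tau, Nat.primeFactors_prod hS]
  refine Finset.prod_congr rfl fun l hl => ?_
  rw [factorization_prod_primes hS hl, tauPrime]
  simp

lemma four_mul_quarticExponent {q : ℕ} (hq : q.Prime) (hq2 : q ≠ 2) :
    4 * quarticExponent q = tauPrime q + 1 := by
  have := hq.eq_two_or_odd
  have := hq.two_le
  unfold quarticExponent tauPrime
  split_ifs <;> omega

lemma localMoment_of_mod_eq_zero {q : ℕ} (hq : q.Prime) (hq2 : q ≠ 2) {k : ℕ} (hk : k % 4 = 0) :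
    localMoment q k = tauPrime q := by
  have h := four_mul_quarticExponent hq hq2
  have hk2 : Even k := Nat.even_iff.mpr (by omega)
  rw [localMoment, if_pos (by omega), ← pow_mul, (hk2.mul_left _).neg_one_pow]
  have : (4 * (quarticExponent q : ℤ)) = tauPrime q + 1 := by exact_mod_cast h
  rw [this]; ring

lemma localMoment_of_mod_eq_two {q k : ℕ} (hk : k % 4 = 2) : localMoment q k = -1 := by
  have hk2 : Even k := Nat.even_iff.mpr (by omega)
  rw [localMoment, if_neg (by omega), ← pow_mul, (hk2.mul_left _).neg_one_pow]
  norm_num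

lemma localMoment_of_odd {q : ℕ} (hq : q.Prime) (hq2 : q ≠ 2) {k : ℕ} (hk : k % 2 = 1) :
    localMoment q k = if q ≡ 1 [MOD 8] ∨ q ≡ 7 [MOD 8] then -1 else 1 := by
  have hk2 : Odd k := Nat.odd_iff.mpr hk
  have hodd := hq.eq_two_or_odd
  have hn : Even (quarticExponent q) ↔ q ≡ 1 [MOD 8] ∨ q ≡ 7 [MOD 8] := by
    unfold quarticExponent Nat.ModEq
    rw [Nat.even_iff]
    split_ifs <;> omega
  rw [localMoment, if_neg (by omega), ← pow_mul, mul_comm, pow_mul, hk2.neg_one_pow]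
  split_ifs with h
  · rw [(hn.mpr h).neg_one_pow]; norm_num
  · rw [(Nat.not_even_iff_odd.mp (hn.not.mpr h)).neg_one_pow]; norm_num

lemma prod_sign_eq (P : Finset ℕ) :
    ∏ q ∈ P, (if q ≡ 1 [MOD 8] ∨ q ≡ 7 [MOD 8] then -1 else 1 : ℤ) =
      (-1) ^ (countMod8 P 1 + countMod8 P 7) := by
  rw [← Finset.prod_filter, Finset.prod_const, Finset.filter_or, Finset.card_union_of_disjoint]
  · rfl
  · rw [Finset.disjoint_filter]
    intro q _ h1 h7
    unfold Nat.ModEq at *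
    omega

/-- The exponents `1`, `2`, `3` on the three given sets of primes. -/
def exponent (P Q : Finset ℕ) (q : ℕ) : ℕ := if q ∈ P then 1 else if q ∈ Q then 2 else 3

lemma prod_union_exponent {A : Type*} [CommMonoid A] {P Q L : Finset ℕ} (hPQ : Disjoint P Q)
    (hPL : Disjoint P L) (hQL : Disjoint Q L) (f : ℕ → ℕ → A) :
    ∏ q ∈ P ∪ Q ∪ L, f q (exponent P Q q) =
      (∏ q ∈ P, f q 1) * (∏ q ∈ Q, f q 2) * ∏ q ∈ L, f q 3 := by
  rw [Finset.prod_union (Finset.disjoint_union_left.mpr ⟨hPL, hQL⟩), Finset.prod_union hPQ]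
  congr 1
  · congr 1
    · exact Finset.prod_congr rfl fun q hq => by rw [exponent, if_pos hq]
    · refine Finset.prod_congr rfl fun q hq => ?_
      rw [exponent, if_neg (Finset.disjoint_right.mp hPQ hq), if_pos hq]
  · refine Finset.prod_congr rfl fun q hq => ?_
    rw [exponent, if_neg (Finset.disjoint_right.mp hPL hq),
      if_neg (Finset.disjoint_right.mp hQL hq)]

lemma exists_sign_prod_eq (S : Finset ℕ) (e : ℕ → ℕ) :
    ∃ a : ℤ, (a = 1 ∨ a = -1) ∧
      ∏ q ∈ S, (q : ℤ) ^ e q = a * ∏ q ∈ S, primaryPrime q ^ e q := by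
  refine ⟨∏ q ∈ S, (if q % 4 = 1 then 1 else -1) ^ e q, ?_, ?_⟩
  · refine Finset.prod_induction _ (fun a : ℤ => a = 1 ∨ a = -1) ?_ (Or.inl rfl) ?_
    · rintro a b (rfl | rfl) (rfl | rfl) <;> simp
    · intro q _
      split_ifs
      · simp
      · exact neg_one_pow_eq_or ℤ _
  · rw [← Finset.prod_mul_distrib]
    refine Finset.prod_congr rfl fun q _ => ?_
    rw [← mul_pow, primaryPrime]
    congr 1
    split_ifs <;> ring

lemma prod_primaryPrime_modEq {S : Finset ℕ} (hS : ∀ q ∈ S, q.Prime ∧ q ≠ 2) (e : ℕ → ℕ) :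
    ∏ q ∈ S, primaryPrime q ^ e q ≡ 1 [ZMOD 4] := by
  refine Finset.prod_induction _ (fun a : ℤ => a ≡ 1 [ZMOD 4]) ?_ rfl ?_
  · intro a b ha hb
    simpa using ha.mul hb
  · intro q hq
    have h : primaryPrime q ≡ 1 [ZMOD 4] := by
      have := (hS q hq).1.eq_two_or_odd
      have := (hS q hq).2
      unfold primaryPrime Int.ModEq
      split_ifs <;> omega
    simpa using h.pow (e q)

/-- The class of `D` modulo powers of `2` determines the fourth root of unity `w` that carries the
contribution of the sign and of the powers of `2`. -/
lemma twoSymbol_base_eq {a R D : ℤ} {σ : ℕ} (ha : a = 1 ∨ a = -1) (hσ : σ ≤ 3)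
    (hR : R ≡ 1 [ZMOD 4]) (hD : D = a * 2 ^ σ * R) :
    ((D ≡ 1 [ZMOD 4] ∨ (4 ∣ D ∧ D / 4 ≡ 3 [ZMOD 4])) →
      (a : GaussianInt) * ⟨0, 1⟩ ^ σ = 1) ∧
    ((D ≡ 3 [ZMOD 4] ∨ (4 ∣ D ∧ D / 4 ≡ 1 [ZMOD 4])) →
      (a : GaussianInt) * ⟨0, 1⟩ ^ σ = -1) ∧
    (((2 ∣ D ∧ ¬ 4 ∣ D) ∨ (8 ∣ D ∧ ¬ 16 ∣ D)) →
      ((a : GaussianInt) * ⟨0, 1⟩ ^ σ = ⟨0, 1⟩ ∨ (a : GaussianInt) * ⟨0, 1⟩ ^ σ = ⟨0, -1⟩)) := by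
  unfold Int.ModEq at *
  rcases ha with rfl | rfl <;> interval_cases σ <;> refine ⟨fun h => ?_, fun h => ?_, fun h => ?_⟩ <;>
    first
    | decide
    | (exfalso; norm_num at hD; omega)

end LangTrotter

/-- Densities of `a_p(E_D) = 2` and `a_p(E_D) = -2` among the primes `p = 1 + x ^ 2`, where
`D = ± 2 ^ σ p_1 ⋯ p_r (q_1 ⋯ q_s) ^ 2 (l_1 ⋯ l_t) ^ 3` with distinct odd primes `p_i` (the
elements of `P`), `q_i` (the elements of `Q`) and `l_i` (the elements of `L`). -/
theorem mainTheorem4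
    (hHL : LangTrotter.HardyLittlewoodConjecture)
    (ε : ℤˣ) (σ : ℕ) (hσ : σ ≤ 3) (P Q L : Finset ℕ)
    (hP : ∀ l ∈ P, l.Prime ∧ Odd l) (hQ : ∀ l ∈ Q, l.Prime ∧ Odd l)
    (hL : ∀ l ∈ L, l.Prime ∧ Odd l)
    (hPQ : Disjoint P Q) (hPL : Disjoint P L) (hQL : Disjoint Q L)
    (D : ℤ)
    (hD : D = (ε : ℤ) * 2 ^ σ * (∏ l ∈ P, (l : ℤ)) * (∏ l ∈ Q, (l : ℤ)) ^ 2 *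
      (∏ l ∈ L, (l : ℤ)) ^ 3) :
    ((D ≡ 1 [ZMOD 4] ∨ (4 ∣ D ∧ D / 4 ≡ 3 [ZMOD 4])) →
      LangTrotter.HasTraceDensity D 1
        (1 / 4 * (1
          + (-1 : ℝ) ^ (P.card + L.card) / (LangTrotter.tau ((∏ l ∈ P, l) * ∏ l ∈ L, l) : ℝ)
          + 2 * (-1 : ℝ) ^ (LangTrotter.countMod8 P 1 + LangTrotter.countMod8 P 7 + Q.card
                + LangTrotter.countMod8 L 1 + LangTrotter.countMod8 L 7)
              / (LangTrotter.tau ((∏ l ∈ P, l) * (∏ l ∈ Q, l) * ∏ l ∈ L, l) : ℝ)))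
      ∧ LangTrotter.HasTraceDensity D (-1)
        (1 / 4 * (1
          + (-1 : ℝ) ^ (P.card + L.card) / (LangTrotter.tau ((∏ l ∈ P, l) * ∏ l ∈ L, l) : ℝ)
          - 2 * (-1 : ℝ) ^ (LangTrotter.countMod8 P 1 + LangTrotter.countMod8 P 7 + Q.card
                + LangTrotter.countMod8 L 1 + LangTrotter.countMod8 L 7)
              / (LangTrotter.tau ((∏ l ∈ P, l) * (∏ l ∈ Q, l) * ∏ l ∈ L, l) : ℝ))))
    ∧ ((D ≡ 3 [ZMOD 4] ∨ (4 ∣ D ∧ D / 4 ≡ 1 [ZMOD 4])) →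
      LangTrotter.HasTraceDensity D 1
        (1 / 4 * (1
          + (-1 : ℝ) ^ (P.card + L.card) / (LangTrotter.tau ((∏ l ∈ P, l) * ∏ l ∈ L, l) : ℝ)))
      ∧ LangTrotter.HasTraceDensity D (-1)
        (1 / 4 * (1
          + (-1 : ℝ) ^ (P.card + L.card) / (LangTrotter.tau ((∏ l ∈ P, l) * ∏ l ∈ L, l) : ℝ))))
    ∧ (((2 ∣ D ∧ ¬ 4 ∣ D) ∨ (8 ∣ D ∧ ¬ 16 ∣ D)) →
      LangTrotter.HasTraceDensity D 1 (1 / 4) ∧ LangTrotter.HasTraceDensity D (-1) (1 / 4)) := by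
  have hPp : ∀ q ∈ P, q.Prime := fun q hq => (hP q hq).1
  have hQp : ∀ q ∈ Q, q.Prime := fun q hq => (hQ q hq).1
  have hLp : ∀ q ∈ L, q.Prime := fun q hq => (hL q hq).1
  have hne : ∀ q : ℕ, Odd q → q ≠ 2 := by
    rintro q hq rfl; exact absurd hq (by decide)
  have hP2 : ∀ q ∈ P, q ≠ 2 := fun q hq => hne q (hP q hq).2
  have hQ2 : ∀ q ∈ Q, q ≠ 2 := fun q hq => hne q (hQ q hq).2
  have hL2 : ∀ q ∈ L, q ≠ 2 := fun q hq => hne q (hL q hq).2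
  have hS : ∀ q ∈ P ∪ Q ∪ L, q.Prime ∧ q ≠ 2 := by
    intro q hq
    rcases Finset.mem_union.mp hq with h | h
    · rcases Finset.mem_union.mp h with h | h
      · exact ⟨hPp q h, hP2 q h⟩
      · exact ⟨hQp q h, hQ2 q h⟩
    · exact ⟨hLp q h, hL2 q h⟩
  have he : ∀ q ∈ P ∪ Q ∪ L, 0 < LangTrotter.exponent P Q q := by
    intro q _
    unfold LangTrotter.exponent
    split_ifs <;> norm_num
  obtain ⟨b, hb, hprod⟩ := LangTrotter.exists_sign_prod_eq (P ∪ Q ∪ L) (LangTrotter.exponent P Q)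
  obtain ⟨a, ha, hDa⟩ : ∃ a : ℤ, (a = 1 ∨ a = -1) ∧
      D = a * 2 ^ σ * ∏ q ∈ P ∪ Q ∪ L, LangTrotter.primaryPrime q ^ LangTrotter.exponent P Q q := by
    refine ⟨ε * b, ?_, ?_⟩
    · rcases Int.units_eq_one_or ε with rfl | rfl <;> rcases hb with rfl | rfl <;> simp
    · rw [LangTrotter.prod_union_exponent hPQ hPL hQL (fun q k => (q : ℤ) ^ k)] at hprod
      simp only [Finset.prod_pow, pow_one] at hprod
      rw [hD]
      linear_combination (ε : ℤ) * 2 ^ σ * hprod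
  obtain ⟨hw1, hw2, hw3⟩ := LangTrotter.twoSymbol_base_eq ha hσ
    (LangTrotter.prod_primaryPrime_modEq hS _) hDa
  -- The products of the local moments.
  have hA : ∀ k, ∏ q ∈ P ∪ Q ∪ L, LangTrotter.localMoment q (LangTrotter.exponent P Q q * k) =
      (∏ q ∈ P, LangTrotter.localMoment q (1 * k)) * (∏ q ∈ Q, LangTrotter.localMoment q (2 * k)) *
        ∏ q ∈ L, LangTrotter.localMoment q (3 * k) := fun k =>
    LangTrotter.prod_union_exponent hPQ hPL hQL fun q j => LangTrotter.localMoment q (j * k)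
  have htau : ∀ (U : Finset ℕ), (∀ q ∈ U, q.Prime) → (∀ q ∈ U, q ≠ 2) → ∀ k, k % 4 = 0 →
      ∏ q ∈ U, LangTrotter.localMoment q k = ∏ q ∈ U, (LangTrotter.tauPrime q : ℤ) :=
    fun U hU hU2 k hk => Finset.prod_congr rfl fun q hq =>
      LangTrotter.localMoment_of_mod_eq_zero (hU q hq) (hU2 q hq) hk
  have hone : ∀ (U : Finset ℕ) (k : ℕ), k % 4 = 2 →
      ∏ q ∈ U, LangTrotter.localMoment q k = (-1) ^ U.card := by
    intro U k hk
    rw [Finset.prod_congr rfl fun q _ => LangTrotter.localMoment_of_mod_eq_two hk,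
      Finset.prod_const]
  have hodd : ∀ (U : Finset ℕ), (∀ q ∈ U, q.Prime) → (∀ q ∈ U, q ≠ 2) → ∀ k, k % 2 = 1 →
      ∏ q ∈ U, LangTrotter.localMoment q k =
        (-1) ^ (LangTrotter.countMod8 U 1 + LangTrotter.countMod8 U 7) := by
    intro U hU hU2 k hk
    rw [← LangTrotter.prod_sign_eq]
    exact Finset.prod_congr rfl fun q hq =>
      LangTrotter.localMoment_of_odd (hU q hq) (hU2 q hq) hk
  have hA1 := hA 1
  have hA2 := hA 2
  have hA3 := hA 3
  have hA4 := hA 4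
  rw [hodd P hPp hP2 _ rfl, hone Q _ rfl, hodd L hLp hL2 _ rfl] at hA1 hA3
  rw [hone P _ rfl, htau Q hQp hQ2 _ rfl, hone L _ rfl] at hA2
  rw [htau P hPp hP2 _ rfl, htau Q hQp hQ2 _ rfl, htau L hLp hL2 _ rfl] at hA4
  have ht1 : LangTrotter.tau ((∏ l ∈ P, l) * ∏ l ∈ L, l) =
      (∏ q ∈ P, LangTrotter.tauPrime q) * ∏ q ∈ L, LangTrotter.tauPrime q := by
    rw [← Finset.prod_union hPL, LangTrotter.tau_prod_primes, Finset.prod_union hPL]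
    intro q hq
    exact (Finset.mem_union.mp hq).elim (hPp q) (hLp q)
  have ht2 : LangTrotter.tau ((∏ l ∈ P, l) * (∏ l ∈ Q, l) * ∏ l ∈ L, l) =
      (∏ q ∈ P, LangTrotter.tauPrime q) * (∏ q ∈ Q, LangTrotter.tauPrime q) *
        ∏ q ∈ L, LangTrotter.tauPrime q := by
    have hd := Finset.disjoint_union_left.mpr ⟨hPL, hQL⟩
    rw [← Finset.prod_union hPQ, ← Finset.prod_union hd,
      LangTrotter.tau_prod_primes fun q hq => (hS q hq).1, Finset.prod_union hd,
      Finset.prod_union hPQ]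
  have hnz : ∀ U : Finset ℕ, (∀ q ∈ U, q.Prime) →
      ((∏ q ∈ U, LangTrotter.tauPrime q : ℕ) : ℝ) ≠ 0 := fun U hU =>
    Nat.cast_ne_zero.mpr (Finset.prod_ne_zero_iff.mpr fun q hq =>
      LangTrotter.tauPrime_ne_zero (hU q hq))
  have hzP := hnz P hPp
  have hzQ := hnz Q hQp
  have hzL := hnz L hLp
  have main : ∀ ζ : ℤ, ζ = 1 ∨ ζ = -1 → _ := fun ζ hζ =>
    LangTrotter.hasTraceDensity_of_factorization hHL hS he ha hDa rfl (fun _ => rfl) hζ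
  simp only [hA1, hA2, hA3, hA4] at main
  rw [ht1, ht2]
  push_cast at main hzP hzQ hzL ⊢
  generalize (∏ q ∈ P, (LangTrotter.tauPrime q : ℝ)) = tP at *
  generalize (∏ q ∈ Q, (LangTrotter.tauPrime q : ℝ)) = tQ at *
  generalize (∏ q ∈ L, (LangTrotter.tauPrime q : ℝ)) = tL at *
  have e2 : ((-1 : GaussianInt) ^ 3 = 1) = False := eq_false (by decide)
  refine ⟨fun h => ?_, fun h => ?_, fun h => ?_⟩
  · have hw := hw1 h
    simp only [hw, one_pow, if_true] at main
    refine ⟨?_, ?_⟩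
    · convert main 1 (Or.inl rfl) using 1
      push_cast
      field_simp
      ring
    · convert main (-1) (Or.inr rfl) using 1
      push_cast
      field_simp
      ring
  · have hw := hw2 h
    have e3 : ((-1 : GaussianInt) ^ 1 = 1) = False := eq_false (by decide)
    have e4 : ((-1 : GaussianInt) ^ 2 = 1) = True := eq_true (by decide)
    have e5 : ((-1 : GaussianInt) ^ 4 = 1) = True := eq_true (by decide)
    simp only [hw, e2, e3, e4, e5, if_true, if_false] at main
    refine ⟨?_, ?_⟩
    · convert main 1 (Or.inl rfl) using 1
      push_cast
      field_simp
      ring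
    · convert main (-1) (Or.inr rfl) using 1
      push_cast
      field_simp
      ring
  · have hw := hw3 h
    have hwk : ∀ k ∈ ({1, 2, 3} : Finset ℕ), ((a : GaussianInt) * ⟨0, 1⟩ ^ σ) ^ k ≠ 1 := by
      rcases hw with hw | hw <;> rw [hw] <;> decide
    have hw4 : ((a : GaussianInt) * ⟨0, 1⟩ ^ σ) ^ 4 = 1 := by
      rcases hw with hw | hw <;> rw [hw] <;> decide
    simp only [hw4, hwk 1 (by decide), hwk 2 (by decide), hwk 3 (by decide), if_true, if_false]
      at main
    refine ⟨?_, ?_⟩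
    · convert main 1 (Or.inl rfl) using 1
      push_cast
      field_simp
      ring
    · convert main (-1) (Or.inr rfl) using 1
      push_cast
      field_simp
      ring
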